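/- Let $n,k\ge 1$ be integers. Let $\mathfrak B_n$ be the group of signed permutations, i.e. permutations $w$ of $\{-n,\dots,-1,1,\dots,n\}$ with $w(-i)=-w(i)$ for all $i$, and let $X_n=\{w\in\mathfrak B_n : w^{-1}(1)>0\}$. Order $\{-n,\dots,-1,1,\dots,n\}$ as integers, write $a\ll b$ if some element of this set lies strictly between $a$ and $b$ (with $a<b$), and let $i^+$ be the cyclic successor of $i$ in this order (so $(-1)^+=1$ and $n^+=-n$). For $w\in\mathfrak B_n$, let $\operatorname{basc}(w)$ be the number of $i\in\{-1,1,2,\dots,n\}$ with $w(i)\ll w(i^+)$. Let $\alpha_1=2e_1$, $\alpha_j=e_j-e_{j-1}$ $(2\le j\le n)$ be the simple roots of type $C_n$, with positive roots $e_j\pm e_i$ $(i<j)$ and $2e_i$, highest root $\theta=2e_n=a_1\alpha_1+\dots+a_n\alpha_n$, where $a_1=1$ and $a_2=\dots=a_n=2$, and set $\alpha_0=-\theta$. Let $w\in\mathfrak B_n$ act linearly on $\mathbb R^n$ by $w(e_i)=e_{w(i)}$, where $e_{-i}=-e_i$. The circular descent number of $w$ is $\operatorname{cdes}(w)=d_0(w)+\sum_{i=1}^n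 a_i d_i(w)$, where $d_i(w)=1$ if $w(\alpha_i)$ is a negative root and $d_i(w)=0$ otherwise. The half-open type C hypersimplex $\Delta'_{C_n,k}$ is the set of $x\in\mathbb R^n$ with $0\le 2x_1\le 1$, $0\le x_{j}-x_{j-1}\le 1$ for $2\le j\le n$, and $k-1<2x_n\le k$, except that for $k=1$ the last condition is replaced by $0\le 2x_n\le 1$. (It is empty for $k\ge 2n$.) Then there is a polynomial $L$, the Ehrhart polynomial of $\Delta'_{C_n,k}$ with respect to the lattice $\tfrac12\mathbb Z^n$, with $L(r)=|r\Delta'_{C_n,k}\cap\tfrac12\mathbb Z^n|$ for all integers $r\ge 1$, and the $h^*$-polynomial $h^*_{\Delta'_{C_n,k}}(t)$, defined by $$\sum_{r\ge 0}L(r)\,t^r=\frac{h^*_{\Delta'_{C_n,k}}(t)}{(1-t)^{d+1}},\qquad d=\dim\Delta'_{C_n,k},$$ (for the empty set, $d$ is taken to be $0$) is given by $$h^*_{\Delta'_{C_n,k}}(t)=\sum_{\substack{w\in X_n\\ \operatorname{cdes}(w^{-1})=k}}t^{\operatorname{basc}(w)}.$$ -/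

import Mathlib

open scoped Pointwise

namespace TypeC

/-! ### Ehrhart polynomials and `h^*`-polynomials -/

/-- `L` is the Ehrhart polynomial of `P` with respect to `Λ`: each positive dilate `rP` contains
finitely many points of `Λ`, and their number is `L(r)`. -/
def IsEhrhartPolynomial {n : ℕ} (Λ P : Set (Fin n → ℝ)) (L : Polynomial ℚ) : Prop :=
  ∀ r : ℕ, 1 ≤ r →
    (((r : ℝ) • P) ∩ Λ).Finite ∧ L.eval (r : ℚ) = ((((r : ℝ) • P) ∩ Λ).ncard : ℚ)

/-- The dimension of a set: the dimension of its affine span. -/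
noncomputable def dim {n : ℕ} (P : Set (Fin n → ℝ)) : ℕ :=
  Module.finrank ℝ (vectorSpan ℝ P)

/-- `h` is the `h^*`-polynomial of `P` with respect to `Λ`: `P` has an Ehrhart polynomial `L`, and
`(∑_{r ≥ 0} L(r) t^r) * (1 - t)^(dim P + 1) = h(t)` as formal power series in `t`. For a half-open
polytope, `L(0)` is the value at `0` of the Ehrhart polynomial. -/
def IsHStarPolynomial {n : ℕ} (Λ P : Set (Fin n → ℝ)) (h : Polynomial ℤ) : Prop :=
  ∃ L : Polynomial ℚ, IsEhrhartPolynomial Λ P L ∧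
    PowerSeries.mk (fun r : ℕ => L.eval (r : ℚ)) * (1 - PowerSeries.X) ^ (dim P + 1)
      = ((h.map (Int.castRingHom ℚ) : Polynomial ℚ) : PowerSeries ℚ)

/-- The Ehrhart polynomial is unique. -/
theorem IsEhrhartPolynomial.unique {n : ℕ} {Λ P : Set (Fin n → ℝ)} {L M : Polynomial ℚ}
    (hL : IsEhrhartPolynomial Λ P L) (hM : IsEhrhartPolynomial Λ P M) : L = M := by
  apply Polynomial.eq_of_infinite_eval_eq
  apply Set.Infinite.mono (s := (fun r : ℕ => (r : ℚ)) '' Set.Ici 1)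
  · rintro _ ⟨r, hr, rfl⟩
    exact ((hL r hr).2).trans ((hM r hr).2).symm
  · exact (Set.Ici_infinite 1).image Nat.cast_injective.injOn

/-- The `h^*`-polynomial is unique. -/
theorem IsHStarPolynomial.unique {n : ℕ} {Λ P : Set (Fin n → ℝ)} {g h : Polynomial ℤ}
    (hg : IsHStarPolynomial Λ P g) (hh : IsHStarPolynomial Λ P h) : g = h := by
  obtain ⟨L, hL, eL⟩ := hg
  obtain ⟨M, hM, eM⟩ := hh
  obtain rfl := hL.unique hM
  have := Polynomial.coe_injective ℚ (eL.symm.trans eM)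
  exact Polynomial.map_injective _ Int.cast_injective this

/-! ### Type C hypersimplices -/

/-- The lattice `½ℤⁿ`. -/
def halfLattice (n : ℕ) : Set (Fin n → ℝ) :=
  {x | ∀ i, ∃ z : ℤ, x i = (z : ℝ) / 2}

/-- The fundamental parallelepiped of type `C_n`:
`0 ≤ 2 x_1, x_2 - x_1, …, x_n - x_{n-1} ≤ 1`. The coordinate `x_j` is `x i` with `j = i + 1`. -/
def parallelepiped (n : ℕ) : Set (Fin n → ℝ) :=
  {x | (∀ i : Fin n, (i : ℕ) = 0 → 0 ≤ 2 * x i ∧ 2 * x i ≤ 1) ∧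
       (∀ i j : Fin n, (j : ℕ) = (i : ℕ) + 1 → 0 ≤ x j - x i ∧ x j - x i ≤ 1)}

/-- The half-open hypersimplex of type `C_n`: the part of the parallelepiped where
`k - 1 < 2 x_n ≤ k`, except that for `k = 1` the condition is `0 ≤ 2 x_n ≤ 1`. -/
def halfOpenHypersimplex (n k : ℕ) : Set (Fin n → ℝ) :=
  {x | x ∈ parallelepiped n ∧ ∀ i : Fin n, (i : ℕ) + 1 = n →
    (if k = 1 then 0 ≤ 2 * x i else (k : ℝ) - 1 < 2 * x i) ∧ 2 * x i ≤ (k : ℝ)}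

/-! ### Signed permutations -/

/-- The set `{-n, …, -1, 1, …, n}`. -/
abbrev Letter (n : ℕ) : Type :=
  {z : ℤ // z ≠ 0 ∧ -(n : ℤ) ≤ z ∧ z ≤ n}

instance (n : ℕ) : Fintype (Letter n) :=
  Fintype.subtype (((Finset.range (2 * n + 1)).image fun m : ℕ => (m : ℤ) - n).erase 0) (by
    intro z
    simp only [Finset.mem_erase, Finset.mem_image, Finset.mem_range]
    constructor
    · rintro ⟨h, m, hm, rfl⟩
      exact ⟨h, by omega, by omega⟩
    · rintro ⟨h, h1, h2⟩
      exact ⟨h, (z + n).toNat, by omega, by omega⟩)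

/-- The letter `-z`. -/
def Letter.neg {n : ℕ} (z : Letter n) : Letter n :=
  ⟨-z.1, by have := z.2; omega⟩

/-- The positive letter `i + 1`, for `i = 0, …, n - 1`. -/
def Letter.pos {n : ℕ} (i : Fin n) : Letter n :=
  ⟨(i : ℤ) + 1, by have := i.2; omega⟩

/-- The cyclic successor of a letter in the order `-n < ⋯ < -1 < 1 < ⋯ < n`. -/
def Letter.succ {n : ℕ} (z : Letter n) : Letter n :=
  ⟨if z.1 = n then -(n : ℤ) else if z.1 = -1 then 1 else z.1 + 1, by
    have := z.2; split_ifs <;> omega⟩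

/-- The group `𝔅_n` of signed permutations: permutations `w` of the letters with
`w(-i) = -w(i)`. -/
def signedPerms (n : ℕ) : Subgroup (Equiv.Perm (Letter n)) where
  carrier := {w | ∀ i, w i.neg = (w i).neg}
  one_mem' := fun _ => rfl
  mul_mem' := by
    intro a b ha hb i
    change ∀ i, a i.neg = (a i).neg at ha
    change ∀ i, b i.neg = (b i).neg at hb
    change (a * b) i.neg = ((a * b) i).neg
    rw [Equiv.Perm.mul_apply, Equiv.Perm.mul_apply, hb, ha]
  inv_mem' := by
    intro a ha i
    change ∀ i, a i.neg = (a i).neg at ha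
    rw [Equiv.Perm.inv_eq_iff_eq, ha]
    congr 1
    exact (a.apply_symm_apply i).symm

instance (n : ℕ) : DecidablePred (· ∈ signedPerms n) := fun w =>
  inferInstanceAs (Decidable (∀ i, w i.neg = (w i).neg))

/-- The type of signed permutations of length `n`. -/
abbrev SignedPerm (n : ℕ) : Type := signedPerms n

/-- `w ∈ X_n`, that is, `w⁻¹(1) > 0`. -/
def InX {n : ℕ} (w : SignedPerm n) : Prop :=
  ∀ j : Letter n, j.1 = 1 → 0 < ((w⁻¹).1 j).1

instance {n : ℕ} (w : SignedPerm n) : Decidable (InX w) := by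
  unfold InX; infer_instance

/-! ### Big ascents -/

/-- `i ≪ j`: some letter lies strictly between `i` and `j`. -/
def MuchLess {n : ℕ} (i j : Letter n) : Prop := ∃ k : Letter n, i.1 < k.1 ∧ k.1 < j.1

instance {n : ℕ} (i j : Letter n) : Decidable (MuchLess i j) := by
  unfold MuchLess; infer_instance

/-- The number of big ascents: positions `i ∈ {-1, 1, 2, …, n}` with `w(i) ≪ w(i⁺)`, where `i⁺` is
the cyclic successor of `i`. -/
def basc {n : ℕ} (w : SignedPerm n) : ℕ :=
  (Finset.univ.filter fun i : Letter n =>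
    (i.1 = -1 ∨ 0 < i.1) ∧ MuchLess (w.1 i) (w.1 i.succ)).card

/-! ### The root system of type C and circular descents -/

/-- The vector `e_z`, where `e_{-i} = -e_i`. The coordinate with index `m` is the `(m + 1)`-st. -/
def basisVec {n : ℕ} (z : Letter n) : Fin n → ℤ := fun m =>
  if z.1 = (m : ℤ) + 1 then 1 else if z.1 = -((m : ℤ) + 1) then -1 else 0

/-- The linear action of a signed permutation: `e_i` is sent to `e_{w(i)}`. -/
def act {n : ℕ} (w : SignedPerm n) (v : Fin n → ℤ) : Fin n → ℤ :=
  ∑ i : Fin n, v i • basisVec (w.1 (Letter.pos i))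

/-- The positive roots of type `C_n`: `e_j + e_i` and `e_j - e_i` for `i < j`, and `2 e_i`. -/
def IsPositiveRoot {n : ℕ} (v : Fin n → ℤ) : Prop :=
  (∃ i j : Fin n, i < j ∧
    (v = Pi.single j 1 + Pi.single i 1 ∨ v = Pi.single j 1 - Pi.single i 1)) ∨
  ∃ i : Fin n, v = Pi.single i 2

instance {n : ℕ} (v : Fin n → ℤ) : Decidable (IsPositiveRoot v) := by
  unfold IsPositiveRoot; infer_instance

/-- The simple roots `α_1 = 2 e_1` and `α_j = e_j - e_{j-1}` for `j ≥ 2`; here `j = i + 1`. -/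
def simpleRoot {n : ℕ} (i : Fin n) : Fin n → ℤ :=
  if (i : ℕ) = 0 then Pi.single i 2
  else Pi.single i 1 - Pi.single ⟨(i : ℕ) - 1, lt_of_le_of_lt (Nat.sub_le _ _) i.2⟩ 1

/-- The highest root `θ = 2 e_n`. -/
def highestRoot (n : ℕ) : Fin n → ℤ := fun m => if (m : ℕ) + 1 = n then 2 else 0

/-- The coefficients in `θ = α_1 + 2 α_2 + ⋯ + 2 α_n`. -/
def mark {n : ℕ} (i : Fin n) : ℕ := if (i : ℕ) = 0 then 1 else 2

/-- `1` if `w` sends the root `v` to a negative root, and `0` otherwise. -/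
def inversionIndicator {n : ℕ} (w : SignedPerm n) (v : Fin n → ℤ) : ℕ :=
  if IsPositiveRoot (-(act w v)) then 1 else 0

/-- The circular descent number `d_0(w) + a_1 d_1(w) + ⋯ + a_n d_n(w)`, where `d_i(w) = 1` if
`w(α_i)` is a negative root and `d_i(w) = 0` otherwise, and `α_0 = -θ`. -/
def cdes {n : ℕ} (w : SignedPerm n) : ℕ :=
  inversionIndicator w (-(highestRoot n)) +
    ∑ i : Fin n, mark i * inversionIndicator w (simpleRoot i)

end TypeC

/-! Put `y = 2x` and extend it to an odd function on the letters. The inequalities of the dilated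
parallelepiped then take one uniform shape, `0 ≤ y(b) - y(a) ≤ 2r` for every covering pair `a ⋖ b`;
the pair `-1 ⋖ 1` encodes the bounds on `2x_1`.

Fold each value as `y = p + 2rm` with `|p| ≤ r`, the ambiguity at `±r` being settled by the sign of
`y`. Sorting the letters by `p`, then by decreasing `m`, then as integers, singles out a signed
permutation `w`. The inequalities force `m` to increase by one at each descent of `w⁻¹` and to stay
constant elsewhere, so `m` is the `winding` of `w⁻¹` and depends on `w` only. What remains is the
chain `z = p ∘ w`, with `0 ≤ z_1 ≤ ⋯ ≤ z_n ≤ r`, and the tie-breaking rules require strict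
inequality precisely at the big ascents of `w`. Conversely each such chain unfolds to a point `y`.
Thus the lattice points split into half-open simplices indexed by `w ∈ X_n` (`exists_foldPoint_eq`,
`foldPoint_mem`, `foldPoint_inj`). The value of `y` at the letter `n` shows that the slab is the one
numbered `cdes w⁻¹` (`inSlab_foldPoint`).

A chain with `b` strict inequalities can be chosen in `(r + n - b).choose n` ways
(`card_gappedChains`), with generating function `t^b / (1 - t)^(n+1)`; summing over `w` gives the
theorem. For `k < 2n` the dimension is `n`; for larger `k` no `w` contributes. -/

namespace TypeC

/-! ### Letters -/

namespace Letter

variable {n : ℕ}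

@[simp] theorem neg_val (a : Letter n) : (Letter.neg a).1 = -a.1 := rfl

@[simp] theorem pos_val (i : Fin n) : (Letter.pos i : Letter n).1 = (i : ℤ) + 1 := rfl

@[simp] theorem neg_neg (a : Letter n) : Letter.neg (Letter.neg a) = a :=
  Subtype.ext (by simp)

theorem exists_pos_or_neg (a : Letter n) :
    ∃ i : Fin n, a = Letter.pos i ∨ a = Letter.neg (Letter.pos i) := by
  have h := a.2
  rcases lt_or_gt_of_ne h.1 with h0 | h0
  · exact ⟨⟨(-a.1 - 1).toNat, by omega⟩, Or.inr (Subtype.ext (by simp; omega))⟩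
  · exact ⟨⟨(a.1 - 1).toNat, by omega⟩, Or.inl (Subtype.ext (by simp; omega))⟩

theorem pos_injective : Function.Injective (Letter.pos : Fin n → Letter n) := by
  intro i j h
  have := congrArg Subtype.val h
  simp at this
  exact Fin.ext this

theorem lt_iff_val {a b : Letter n} : a < b ↔ a.1 < b.1 := Iff.rfl

theorem neg_lt_neg {a b : Letter n} : Letter.neg a < Letter.neg b ↔ b < a := by
  simp only [lt_iff_val, neg_val]; omega

/-- The letter `n`. -/
def last (hn : 1 ≤ n) : Letter n := ⟨n, by omega, by omega, le_refl _⟩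

@[simp] theorem last_val (hn : 1 ≤ n) : (last hn).1 = n := rfl

theorem le_last (hn : 1 ≤ n) (a : Letter n) : a ≤ last hn := a.2.2.2

theorem covBy_iff {a b : Letter n} :
    a ⋖ b ↔ (a.1 = -1 ∧ b.1 = 1) ∨ b.1 = a.1 + 1 := by
  have ha := a.2
  have hb := b.2
  constructor
  · rintro ⟨h1, h2⟩
    rw [lt_iff_val] at h1
    by_contra hc
    push Not at hc
    by_cases h : a.1 = -1
    · have h3 := @h2 ⟨1, by omega, by omega, by omega⟩ (by rw [lt_iff_val]; simp; omega)
      rw [lt_iff_val] at h3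
      simp at h3
      omega
    · have h3 := @h2 ⟨a.1 + 1, by omega, by omega, by omega⟩ (by rw [lt_iff_val]; simp)
      rw [lt_iff_val] at h3
      simp at h3
      omega
  · intro h
    refine ⟨by rw [lt_iff_val]; omega, fun c h1 h2 => ?_⟩
    rw [lt_iff_val] at h1 h2
    have hc := c.2
    omega

/-- A covering pair is either `-1 ⋖ 1`, a pair of positive letters, or the negative of one. -/
theorem covBy_cases {a b : Letter n} (h : a ⋖ b) :
    (∃ i : Fin n, (i : ℕ) = 0 ∧ a = Letter.neg (Letter.pos i) ∧ b = Letter.pos i) ∨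
    (∃ i j : Fin n, (j : ℕ) = i + 1 ∧ a = Letter.pos i ∧ b = Letter.pos j) ∨
    (∃ i j : Fin n, (j : ℕ) = i + 1 ∧ a = Letter.neg (Letter.pos j) ∧
      b = Letter.neg (Letter.pos i)) := by
  rw [covBy_iff] at h
  obtain ⟨i, rfl | rfl⟩ := exists_pos_or_neg a <;> obtain ⟨j, rfl | rfl⟩ := exists_pos_or_neg b <;>
    simp only [neg_val, pos_val] at h
  · exact Or.inr (Or.inl ⟨i, j, by omega, rfl, rfl⟩)
  · omega
  · have : i = j := Fin.ext (by omega)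
    subst this
    exact Or.inl ⟨i, by omega, rfl, rfl⟩
  · exact Or.inr (Or.inr ⟨j, i, by omega, rfl, rfl⟩)

theorem pos_covBy_pos {i j : Fin n} (h : (j : ℕ) = i + 1) :
    (Letter.pos i : Letter n) ⋖ Letter.pos j := by
  rw [covBy_iff]; simp; omega

theorem neg_pos_covBy_pos {i : Fin n} (h : (i : ℕ) = 0) :
    Letter.neg (Letter.pos i) ⋖ Letter.pos i := by
  rw [covBy_iff]; simp; omega

theorem strictMono_of_covBy {β : Type*} [Preorder β] {f : Letter n → β}
    (h : ∀ a b, a ⋖ b → f a < f b) : StrictMono f := by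
  let : LocallyFiniteOrder (Letter n) := Fintype.toLocallyFiniteOrder
  exact (strictMono_iff_forall_covBy f).2 h

theorem monotone_of_covBy {β : Type*} [Preorder β] {f : Letter n → β}
    (h : ∀ a b, a ⋖ b → f a ≤ f b) : Monotone f := by
  let : LocallyFiniteOrder (Letter n) := Fintype.toLocallyFiniteOrder
  exact (monotone_iff_forall_covBy f).2 h

theorem succ_of_ne {a : Letter n} (h : a.1 ≠ n) : a ⋖ Letter.succ a := by
  rw [covBy_iff]
  simp only [Letter.succ]
  split_ifs <;> omega

theorem eq_of_covBy {a b c : Letter n} (h : a ⋖ b) (h' : a ⋖ c) : b = c := by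
  rw [covBy_iff] at h h'
  have := a.2
  have := b.2
  have := c.2
  exact Subtype.ext (by omega)

theorem succ_eq_of_covBy {a b : Letter n} (h : a ⋖ b) : Letter.succ a = b := by
  refine eq_of_covBy (succ_of_ne ?_) h
  have h1 := (lt_iff_val.1 h.1)
  have := b.2
  omega

theorem succ_last (hn : 1 ≤ n) : Letter.succ (last hn) = Letter.neg (last hn) :=
  Subtype.ext (by simp [Letter.succ])

end Letter

theorem MuchLess.lt {n : ℕ} {a b : Letter n} (h : MuchLess a b) : a < b := by
  obtain ⟨c, h1, h2⟩ := h
  exact Letter.lt_iff_val.2 (h1.trans h2)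

theorem covBy_of_not_muchLess {n : ℕ} {a b : Letter n} (h : ¬ MuchLess a b) (hab : a < b) :
    a ⋖ b :=
  ⟨hab, fun c h1 h2 => h ⟨c, h1, h2⟩⟩

theorem MuchLess.neg {n : ℕ} {a b : Letter n} (h : MuchLess a b) :
    MuchLess (Letter.neg b) (Letter.neg a) := by
  obtain ⟨c, h1, h2⟩ := h
  exact ⟨Letter.neg c, by simp; omega, by simp; omega⟩

/-! ### Odd functions on letters -/

/-- The odd extension to all letters of a function on positive letters. -/
def oddExt {n : ℕ} (y : Fin n → ℤ) (a : Letter n) : ℤ :=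
  if h : 0 < a.1 then y ⟨(a.1 - 1).toNat, by have := a.2; omega⟩
  else -y ⟨(-a.1 - 1).toNat, by have := a.2; omega⟩

section oddExt

variable {n : ℕ}

@[simp] theorem oddExt_pos (y : Fin n → ℤ) (i : Fin n) : oddExt y (Letter.pos i) = y i := by
  rw [oddExt, dif_pos (by simp)]
  congr 1
  exact Fin.ext (by simp)

@[simp] theorem oddExt_neg (y : Fin n → ℤ) (a : Letter n) :
    oddExt y (Letter.neg a) = -oddExt y a := by
  have key : ∀ i : Fin n, oddExt y (Letter.neg (Letter.pos i)) = - y i := by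
    intro i
    rw [oddExt, dif_neg (by simp)]
    congr 2
    exact Fin.ext (by simp)
  obtain ⟨i, rfl | rfl⟩ := Letter.exists_pos_or_neg a
  · rw [key, oddExt_pos]
  · rw [Letter.neg_neg, key, oddExt_pos, neg_neg]

theorem eq_oddExt {f : Letter n → ℤ} (hf : ∀ a, f (Letter.neg a) = -f a) :
    f = oddExt fun i => f (Letter.pos i) := by
  funext a
  obtain ⟨i, rfl | rfl⟩ := Letter.exists_pos_or_neg a <;> simp [hf]

theorem oddExt_injective : Function.Injective (oddExt : (Fin n → ℤ) → Letter n → ℤ) := by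
  intro y z h
  funext i
  simpa using congrFun h (Letter.pos i)

/-- An odd function is determined by its increments along covering pairs. -/
theorem odd_eq_of_covBy {f g : Letter n → ℤ} (hf : ∀ a, f (Letter.neg a) = -f a)
    (hg : ∀ a, g (Letter.neg a) = -g a)
    (h : ∀ a b, a ⋖ b → f b - f a = g b - g a) : f = g := by
  -- The difference is both monotone and antitone, hence constant, and an odd constant is zero.
  have h1 : Monotone (fun a => f a - g a) :=
    Letter.monotone_of_covBy fun a b hab => by have := h a b hab; omega
  have h2 : Monotone (fun a => g a - f a) :=
    Letter.monotone_of_covBy fun a b hab => by have := h a b hab; omega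
  funext a
  have h3 := hf a
  have h4 := hg a
  rcases le_total a (Letter.neg a) with h5 | h5
  · have h6 := h1 h5; have h7 := h2 h5; simp only at h6 h7; omega
  · have h6 := h1 h5; have h7 := h2 h5; simp only at h6 h7; omega

theorem oddExt_nonneg {f : Letter n → ℤ} (hf : ∀ a, f (Letter.neg a) = -f a) (hm : Monotone f)
    {a : Letter n} (ha : 0 < a.1) : 0 ≤ f a := by
  have h : Letter.neg a ≤ a := by
    change (Letter.neg a).1 ≤ a.1
    simp; omega
  have := hm h
  rw [hf] at this
  omega

end oddExt

section cdes

variable {n : ℕ}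

namespace SignedPerm

@[simp] theorem apply_neg (w : SignedPerm n) (a : Letter n) :
    w.1 (Letter.neg a) = Letter.neg (w.1 a) := w.2 a

@[simp] theorem apply_inv_apply (w : SignedPerm n) (a : Letter n) :
    w.1 ((w⁻¹).1 a) = a := by
  change w.1 (w.1⁻¹ a) = a
  simp

@[simp] theorem inv_apply_apply (w : SignedPerm n) (a : Letter n) :
    (w⁻¹).1 (w.1 a) = a := by
  change w.1⁻¹ (w.1 a) = a
  simp

end SignedPerm

/-! ### Roots -/

theorem basisVec_pos (i : Fin n) : basisVec (Letter.pos i) = Pi.single i 1 := by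
  funext m
  simp only [basisVec, Letter.pos_val, Pi.single_apply]
  have : (m = i) ↔ (m : ℤ) = i := by rw [Fin.ext_iff]; omega
  simp only [this]
  split_ifs <;> omega

theorem basisVec_neg (a : Letter n) : basisVec (Letter.neg a) = -basisVec a := by
  funext m
  simp only [basisVec, Letter.neg_val, Pi.neg_apply]
  split_ifs <;> omega

theorem act_single (w : SignedPerm n) (i : Fin n) (c : ℤ) :
    act w (Pi.single i c) = c • basisVec (w.1 (Letter.pos i)) := by
  rw [act, Finset.sum_eq_single i]
  · simp
  · intro j _ hj
    simp [hj]
  · simp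

theorem act_sub (w : SignedPerm n) (u v : Fin n → ℤ) : act w (u - v) = act w u - act w v := by
  simp [act, sub_smul]

/-- The sign of the last nonzero coordinate separates positive from negative roots. -/
theorem IsPositiveRoot.exists_leading {v : Fin n → ℤ} (h : IsPositiveRoot v) :
    ∃ j, 0 < v j ∧ ∀ l, j < l → v l = 0 := by
  rcases h with ⟨i, j, hij, rfl | rfl⟩ | ⟨i, rfl⟩
  · refine ⟨j, by simp [hij.ne'], fun l hl => ?_⟩
    simp [hl.ne', (hij.trans hl).ne']
  · refine ⟨j, by simp [hij.ne'], fun l hl => ?_⟩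
    simp [hl.ne', (hij.trans hl).ne']
  · refine ⟨i, by simp, fun l hl => ?_⟩
    simp [hl.ne']

theorem IsPositiveRoot.not_neg {v : Fin n → ℤ} (h : IsPositiveRoot v) :
    ¬ IsPositiveRoot (-v) := by
  intro h'
  obtain ⟨i, hi, hi'⟩ := h.exists_leading
  obtain ⟨j, hj, hj'⟩ := h'.exists_leading
  simp only [Pi.neg_apply] at hj hj'
  rcases lt_trichotomy i j with h1 | rfl | h1
  · have := hi' j h1; omega
  · omega
  · have := hj' i h1; omega

/-- This turns inversions of roots into descents of letters. The excluded case `b = -a` is the long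
root `2 e_b`, treated in `isPositiveRoot_two_smul_basisVec`. -/
theorem isPositiveRoot_sub_of_lt {a b : Letter n} (h : a < b) (h' : b ≠ Letter.neg a) :
    IsPositiveRoot (basisVec b - basisVec a) := by
  obtain ⟨i, rfl | rfl⟩ := Letter.exists_pos_or_neg a <;>
    obtain ⟨j, rfl | rfl⟩ := Letter.exists_pos_or_neg b <;>
    simp only [Letter.lt_iff_val, Letter.neg_val, Letter.pos_val, ne_eq, Letter.neg_neg] at h h' <;>
    simp only [basisVec_neg, basisVec_pos]
  · exact Or.inl ⟨i, j, Fin.lt_def.2 (by omega), Or.inr rfl⟩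
  · omega
  · have hij : i ≠ j := by rintro rfl; exact h' rfl
    rcases lt_or_gt_of_ne hij with h1 | h1
    · exact Or.inl ⟨i, j, h1, Or.inl (by abel)⟩
    · exact Or.inl ⟨j, i, h1, Or.inl (by abel)⟩
  · exact Or.inl ⟨j, i, Fin.lt_def.2 (by omega), Or.inr (by abel)⟩

theorem inversionIndicator_simpleRoot (w : SignedPerm n) {i j : Fin n} (h : (j : ℕ) = i + 1) :
    inversionIndicator w (simpleRoot j) =
      if w.1 (Letter.pos j) < w.1 (Letter.pos i) then 1 else 0 := by
  have hi : (⟨(j : ℕ) - 1, lt_of_le_of_lt (Nat.sub_le _ _) j.2⟩ : Fin n) = i :=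
    Fin.ext (by simp; omega)
  have hne : Letter.pos j ≠ (Letter.pos i : Letter n) := fun h' => by
    have := Letter.pos_injective h'
    subst this
    omega
  have hne' : Letter.pos i ≠ Letter.neg (Letter.pos j : Letter n) := fun h' => by
    have := congrArg Subtype.val h'
    simp at this
    omega
  have hw' : w.1 (Letter.pos i) ≠ Letter.neg (w.1 (Letter.pos j)) := by
    rw [← SignedPerm.apply_neg]
    exact fun h' => hne' (w.1.injective h')
  have hact : act w (simpleRoot j) = basisVec (w.1 (Letter.pos j)) -
      basisVec (w.1 (Letter.pos i)) := by
    rw [simpleRoot, if_neg (by omega), hi, act_sub, act_single, act_single, one_smul, one_smul]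
  rw [inversionIndicator, hact, neg_sub]
  congr 1
  refine propext ⟨fun hp => ?_, fun hlt => isPositiveRoot_sub_of_lt hlt hw'⟩
  by_contra hc
  have hlt : w.1 (Letter.pos i) < w.1 (Letter.pos j) :=
    lt_of_le_of_ne (not_lt.1 hc) fun h' => hne (w.1.injective h').symm
  refine hp.not_neg ?_
  rw [neg_sub]
  refine isPositiveRoot_sub_of_lt hlt fun h' => hw' ?_
  rw [h', Letter.neg_neg]

theorem isPositiveRoot_two_smul_basisVec {a : Letter n} :
    IsPositiveRoot ((2 : ℤ) • basisVec a) ↔ 0 < a.1 := by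
  have key : ∀ i : Fin n, IsPositiveRoot ((2 : ℤ) • basisVec (Letter.pos i)) := fun i =>
    Or.inr ⟨i, by rw [basisVec_pos, ← Pi.single_smul]; simp⟩
  obtain ⟨i, rfl | rfl⟩ := Letter.exists_pos_or_neg a
  · exact iff_of_true (key i) (by simp)
  · refine iff_of_false ?_ (by simp)
    rw [basisVec_neg, smul_neg]
    exact (key i).not_neg

theorem inversionIndicator_simpleRoot_zero (w : SignedPerm n) {i : Fin n} (h : (i : ℕ) = 0) :
    inversionIndicator w (simpleRoot i) = if (w.1 (Letter.pos i)).1 < 0 then 1 else 0 := by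
  rw [inversionIndicator, simpleRoot, if_pos h, act_single, ← smul_neg, ← basisVec_neg]
  simp only [isPositiveRoot_two_smul_basisVec, Letter.neg_val, Left.neg_pos_iff]

theorem inversionIndicator_highestRoot (hn : 1 ≤ n) (w : SignedPerm n) :
    inversionIndicator w (-highestRoot n) = if 0 < (w.1 (Letter.last hn)).1 then 1 else 0 := by
  have hl : (Letter.last hn) = Letter.pos ⟨n - 1, by omega⟩ :=
    Subtype.ext (by simp; omega)
  have hr : highestRoot n = Pi.single ⟨n - 1, by omega⟩ 2 := by
    funext m
    simp only [highestRoot, Pi.single_apply, Fin.ext_iff]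
    have := m.2
    split_ifs <;> omega
  have hneg : act w (-highestRoot n) = - act w (highestRoot n) := by simp [act]
  rw [inversionIndicator, hneg, _root_.neg_neg, hr, act_single, ← hl]
  simp only [isPositiveRoot_two_smul_basisVec]

/-! ### The winding function of a signed permutation -/

/-- The number of descents of `w` among the first `j` positive letters. -/
def winding (w : SignedPerm n) (j : Fin n) : ℤ :=
  ∑ i ∈ Finset.univ.filter (fun i : Fin n => 0 < (i : ℕ) ∧ i ≤ j), (inversionIndicator w (simpleRoot i) : ℤ)

theorem winding_zero (w : SignedPerm n) {j : Fin n} (h : (j : ℕ) = 0) : winding w j = 0 := by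
  rw [winding, Finset.filter_eq_empty_iff.2, Finset.sum_empty]
  intro i _ hi
  have := Fin.le_def.1 hi.2
  omega

theorem winding_succ (w : SignedPerm n) {i j : Fin n} (h : (j : ℕ) = i + 1) :
    winding w j = winding w i + inversionIndicator w (simpleRoot j) := by
  have : (Finset.univ.filter fun l : Fin n => 0 < (l : ℕ) ∧ l ≤ j) =
      insert j (Finset.univ.filter fun l : Fin n => 0 < (l : ℕ) ∧ l ≤ i) := by
    ext l
    simp only [Finset.mem_filter, Finset.mem_univ, true_and, Finset.mem_insert, Fin.le_def,
      Fin.ext_iff]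
    omega
  rw [winding, this, Finset.sum_insert, add_comm]
  · rfl
  · simp only [Finset.mem_filter, Finset.mem_univ, true_and, Fin.le_def]
    omega

/-- The hypothesis `w(1) > 0` rules out a descent from `-1` to `1`, where the odd extension has
increment zero; a descent between negative letters mirrors one between positive letters. -/
theorem oddExt_winding_sub (w : SignedPerm n)
    (hw : ∀ i : Fin n, (i : ℕ) = 0 → 0 < (w.1 (Letter.pos i)).1) {a b : Letter n} (h : a ⋖ b) :
    oddExt (winding w) b - oddExt (winding w) a = if w.1 b < w.1 a then 1 else 0 := by
  rcases Letter.covBy_cases h with ⟨i, hi, rfl, rfl⟩ | ⟨i, j, hij, rfl, rfl⟩ |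
    ⟨i, j, hij, rfl, rfl⟩
  · have := hw i hi
    rw [oddExt_neg, oddExt_pos, winding_zero w hi, SignedPerm.apply_neg, if_neg]
    · simp
    · rw [Letter.lt_iff_val, Letter.neg_val]
      omega
  · rw [oddExt_pos, oddExt_pos, winding_succ w hij, inversionIndicator_simpleRoot w hij]
    push_cast
    ring
  · rw [oddExt_neg, oddExt_neg, oddExt_pos, oddExt_pos, winding_succ w hij,
      inversionIndicator_simpleRoot w hij, SignedPerm.apply_neg, SignedPerm.apply_neg]
    simp only [Letter.neg_lt_neg]
    push_cast
    ring

/-- The term of `α_1` vanishes because `w(1) > 0`, every other simple root has mark 2, and `-θ` is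
sent to a negative root exactly when `w(n) > 0`. -/
theorem cdes_eq (hn : 1 ≤ n) (w : SignedPerm n)
    (hw : ∀ i : Fin n, (i : ℕ) = 0 → 0 < (w.1 (Letter.pos i)).1) :
    (cdes w : ℤ) = (if 0 < (w.1 (Letter.last hn)).1 then 1 else 0) +
      2 * oddExt (winding w) (Letter.last hn) := by
  have hl : (Letter.last hn) = Letter.pos ⟨n - 1, by omega⟩ :=
    Subtype.ext (by simp; omega)
  rw [cdes, inversionIndicator_highestRoot hn]
  push_cast
  congr 1
  rw [hl, oddExt_pos, winding, Finset.mul_sum, Finset.sum_filter]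
  refine Finset.sum_congr rfl fun i _ => ?_
  have := i.2
  by_cases hi : (i : ℕ) = 0
  · rw [inversionIndicator_simpleRoot_zero w hi, if_neg (by have := hw i hi; omega),
      if_neg (by omega)]
    simp
  · rw [if_pos ⟨by omega, Fin.le_def.2 (by simp; omega)⟩, mark, if_neg hi]
    simp

theorem InX.inv_pos {w : SignedPerm n} (h : InX w) (i : Fin n) (hi : (i : ℕ) = 0) :
    0 < ((w⁻¹).1 (Letter.pos i)).1 :=
  h _ (by simp [hi])

end cdes

section bijection

variable {n : ℕ}

/-! ### Reduction modulo `2r` -/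

/-- `p` is the representative of `y` modulo `2r` closest to `0`, with ties broken by the sign of
`y`, and `m` is the quotient. -/
structure IsReduction (r : ℕ) (y p m : ℤ) : Prop where
  eq : y = p + 2 * r * m
  ge : -(r : ℤ) ≤ p
  le : p ≤ r
  pos : p = r → 0 < y
  neg : p = -(r : ℤ) → y < 0

/-- Two remainders differ by a multiple of `2r` of size at most `2r`, so the only ambiguity is `r`
against `-r`, which the sign of `y` settles. -/
theorem IsReduction.unique {r : ℕ} (hr : 1 ≤ r) {y p m p' m' : ℤ} (h : IsReduction r y p m)
    (h' : IsReduction r y p' m') : p = p' ∧ m = m' := by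
  have e : p - p' = 2 * r * (m' - m) := by have := h.eq; have := h'.eq; linarith
  have := h.ge; have := h.le; have := h'.ge; have := h'.le
  have hr' : (1 : ℤ) ≤ r := by exact_mod_cast hr
  rcases lt_trichotomy m m' with hm | hm | hm
  · have h1 : (2 : ℤ) * r * 1 ≤ 2 * r * (m' - m) := by gcongr; omega
    have h2 := h.pos (by linarith)
    have h3 := h'.neg (by linarith)
    omega
  · subst hm
    refine ⟨?_, rfl⟩
    simp at e
    omega
  · have h1 : (2 : ℤ) * r * 1 ≤ 2 * r * (m - m') := by gcongr; omega
    have h2 := h'.pos (by linarith)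
    have h3 := h.neg (by linarith)
    omega

theorem IsReduction.symm {r : ℕ} {y p m : ℤ} (h : IsReduction r y p m) :
    IsReduction r (-y) (-p) (-m) :=
  ⟨by rw [h.eq]; ring, by have := h.le; omega, by have := h.ge; omega,
    fun h' => by have := h.neg (by omega); omega, fun h' => by have := h.pos (by omega); omega⟩

theorem exists_isReduction {r : ℕ} (hr : 1 ≤ r) (y : ℤ) : ∃ p m, IsReduction r y p m := by
  have key : ∀ y : ℤ, 0 ≤ y → ∃ p m, IsReduction r y p m := by
    intro y hy
    have h2r : (0 : ℤ) < 2 * r := by omega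
    have h1 := Int.emod_add_mul_ediv (y + r - 1) (2 * r)
    have h2 := Int.emod_nonneg (y + r - 1) h2r.ne'
    have h3 := Int.emod_lt_of_pos (y + r - 1) h2r
    -- For `y ≥ 0` the remainder is taken in `(-r, r]`; negative `y` follows by symmetry.
    refine ⟨(y + r - 1) % (2 * r) - (r - 1), (y + r - 1) / (2 * r), by linarith, by linarith,
      by linarith, fun h => ?_, fun h => by omega⟩
    rcases hy.eq_or_lt with rfl | hy
    · rw [Int.emod_eq_of_lt (by omega) (by omega)] at h
      omega
    · exact hy
  rcases le_total 0 y with hy | hy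
  · exact key y hy
  · obtain ⟨p, m, h⟩ := key (-y) (by omega)
    exact ⟨-p, -m, by simpa using h.symm⟩

theorem IsReduction.oddExt {r : ℕ} {y p m : Fin n → ℤ} (h : ∀ i, IsReduction r (y i) (p i) (m i))
    (a : Letter n) : IsReduction r (oddExt y a) (oddExt p a) (oddExt m a) := by
  obtain ⟨i, rfl | rfl⟩ := Letter.exists_pos_or_neg a
  · simpa using h i
  · simpa using (h i).symm

/-! ### Sorting letters -/

/-- The key by which letters are sorted: first by `P`, then by decreasing `M`, then as integers. -/
def sortKey (P M : Letter n → ℤ) (a : Letter n) : ℤ ×ₗ ℤ ×ₗ ℤ :=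
  toLex (P a, toLex (-M a, a.1))

theorem sortKey_lt_iff {P M : Letter n → ℤ} {a b : Letter n} :
    sortKey P M a < sortKey P M b ↔ P a < P b ∨ P a = P b ∧ (M b < M a ∨ M a = M b ∧ a < b) := by
  rw [sortKey, sortKey, Prod.Lex.toLex_lt_toLex, Prod.Lex.toLex_lt_toLex]
  simp only [neg_lt_neg_iff, neg_inj, Letter.lt_iff_val]

theorem sortKey_injective (P M : Letter n → ℤ) : Function.Injective (sortKey P M) := by
  intro a b h
  simp only [sortKey, EmbeddingLike.apply_eq_iff_eq, Prod.mk.injEq] at h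
  exact Subtype.ext h.2.2

/-- A finite linear order is sorted by a unique permutation. -/
theorem exists_perm_strictMono {α β : Type*} [Fintype α] [LinearOrder α] [LinearOrder β]
    {f : α → β} (hf : Function.Injective f) : ∃ w : Equiv.Perm α, StrictMono (f ∘ w) := by
  classical
  let s : Finset β := Finset.univ.image f
  have hs : s.card = Fintype.card α := by
    rw [Finset.card_image_of_injective _ hf, Finset.card_univ]
  let e : α ≃o s := (Fintype.orderIsoFinOfCardEq α rfl).symm.trans (s.orderIsoOfFin hs)
  have hmem : ∀ a, ∃ b, f b = e a := by
    intro a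
    obtain ⟨b, -, hb⟩ := Finset.mem_image.1 (e a).2
    exact ⟨b, hb⟩
  choose w hw using hmem
  have hmono : StrictMono (f ∘ w) := by
    intro a b hab
    simp only [Function.comp_apply, hw]
    exact e.strictMono hab
  have hinj : Function.Injective w := fun a b hab =>
    hmono.injective (by simp [hab])
  exact ⟨Equiv.ofBijective w (Finite.injective_iff_bijective.1 hinj), hmono⟩

theorem perm_eq_of_strictMono {α β : Type*} [Finite α] [LinearOrder α] [LinearOrder β]
    {f : α → β} {w w' : Equiv.Perm α} (h : StrictMono (f ∘ w)) (h' : StrictMono (f ∘ w')) :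
    w = w' := by
  have hf : Function.Injective f := by
    have := h.injective
    rwa [Function.Injective.of_comp_iff' _ w.bijective] at this
  have hr : Set.range (f ∘ w) = Set.range (f ∘ w') := by
    rw [Set.range_comp, Set.range_comp, w.surjective.range_eq, w'.surjective.range_eq]
  have := (h.range_inj h').1 hr
  exact Equiv.ext fun a => hf (congrFun this a)

theorem sortKey_neg_lt_neg {P M : Letter n → ℤ} (hP : ∀ a, P (Letter.neg a) = -P a)
    (hM : ∀ a, M (Letter.neg a) = -M a) {a b : Letter n} :
    sortKey P M (Letter.neg a) < sortKey P M (Letter.neg b) ↔ sortKey P M b < sortKey P M a := by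
  rw [sortKey_lt_iff, sortKey_lt_iff, hP, hP, hM, hM, Letter.neg_lt_neg]
  constructor <;> rintro (h | ⟨h, h' | ⟨h', h''⟩⟩) <;> grind

/-- Negation reverses the order of the keys, so conjugating a sorting permutation by negation sorts
again. By uniqueness the conjugate is the same permutation, which therefore commutes with negation.
-/
theorem exists_signedPerm_strictMono {P M : Letter n → ℤ} (hP : ∀ a, P (Letter.neg a) = -P a)
    (hM : ∀ a, M (Letter.neg a) = -M a) :
    ∃ w : SignedPerm n, StrictMono (sortKey P M ∘ w.1) := by
  obtain ⟨w, hw⟩ := exists_perm_strictMono (sortKey_injective P M)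
  let ν : Equiv.Perm (Letter n) := ⟨Letter.neg, Letter.neg, Letter.neg_neg, Letter.neg_neg⟩
  have hν : StrictMono (sortKey P M ∘ (ν * w * ν : Equiv.Perm (Letter n))) := by
    intro a b hab
    exact (sortKey_neg_lt_neg hP hM).2 (hw (Letter.neg_lt_neg.2 hab))
  have he := perm_eq_of_strictMono hw hν
  refine ⟨⟨w, fun a => ?_⟩, hw⟩
  have := congrArg (fun u : Equiv.Perm (Letter n) => u (Letter.neg a)) he
  change w (Letter.neg a) = Letter.neg (w (Letter.neg (Letter.neg a))) at this
  rwa [Letter.neg_neg] at this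

/-! ### Lattice points of the half-open simplices -/

/-- The lattice points of the `r`-th dilate of the half-open simplex indexed by `w`. -/
def simplexPoints (hn : 1 ≤ n) (w : SignedPerm n) (r : ℕ) : Set (Fin n → ℤ) :=
  {z | (∀ a b : Letter n, a ⋖ b → oddExt z a ≤ oddExt z b ∧
      (MuchLess (w.1 a) (w.1 b) → oddExt z a < oddExt z b)) ∧
    oddExt z (Letter.last hn) ≤ r ∧
    (MuchLess (w.1 (Letter.last hn)) (Letter.neg (w.1 (Letter.last hn))) →
      oddExt z (Letter.last hn) < r)}

/-- The condition on `2 x_n` for points of the `r`-th dilate of the half-open hypersimplex. -/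
def InSlab (k r : ℕ) (v : ℤ) : Prop :=
  (if k = 1 then 0 ≤ v else ((k : ℤ) - 1) * r < v) ∧ v ≤ k * r

/-- The points `2x` for `x` a half-integral point of the `r`-th dilate of the half-open
hypersimplex. -/
def hypersimplexPoints (hn : 1 ≤ n) (k r : ℕ) : Set (Fin n → ℤ) :=
  {y | (∀ a b : Letter n, a ⋖ b → 0 ≤ oddExt y b - oddExt y a ∧
      oddExt y b - oddExt y a ≤ 2 * r) ∧ InSlab k r (oddExt y (Letter.last hn))}

theorem InSlab.unique {k k' r : ℕ} {v : ℤ} (hk : 1 ≤ k) (hk' : 1 ≤ k')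
    (h : InSlab k r v) (h' : InSlab k' r v) : k = k' := by
  have key : ∀ {k k' : ℕ}, 1 ≤ k → InSlab k r v → InSlab k' r v → ¬ k < k' := by
    intro k k' hk h h' hlt
    have h1 := h.2
    have h2 := h'.1
    rw [if_neg (by omega)] at h2
    have : (k : ℤ) * r ≤ (k' - 1) * r := by gcongr; omega
    omega
  have := key hk h h'
  have := key hk' h' h
  omega

/-- The lattice point of the parallelepiped attached to a point of a half-open simplex. -/
def foldPoint (w : SignedPerm n) (r : ℕ) (z : Fin n → ℤ) : Fin n → ℤ := fun i =>
  oddExt z ((w⁻¹).1 (Letter.pos i)) + 2 * r * winding w⁻¹ i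

theorem oddExt_foldPoint (w : SignedPerm n) (r : ℕ) (z : Fin n → ℤ) (a : Letter n) :
    oddExt (foldPoint w r z) a = oddExt z ((w⁻¹).1 a) + 2 * r * oddExt (winding w⁻¹) a := by
  obtain ⟨i, rfl | rfl⟩ := Letter.exists_pos_or_neg a
  · simp [foldPoint]
  · simp only [oddExt_neg, oddExt_pos, SignedPerm.apply_neg, foldPoint]
    ring

/-! ### Folding a chain into the hypersimplex -/

section forward

variable {w : SignedPerm n} {r : ℕ} {z : Fin n → ℤ} {hn : 1 ≤ n}

theorem simplexPoints_monotone (hz : z ∈ simplexPoints hn w r) : Monotone (oddExt z) :=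
  Letter.monotone_of_covBy fun a b h => (hz.1 a b h).1

theorem simplexPoints_le (hz : z ∈ simplexPoints hn w r) (a : Letter n) : oddExt z a ≤ r :=
  (simplexPoints_monotone hz (Letter.le_last hn a)).trans hz.2.1

theorem simplexPoints_ge (hz : z ∈ simplexPoints hn w r) (a : Letter n) :
    -(r : ℤ) ≤ oddExt z a := by
  have := simplexPoints_le hz (Letter.neg a)
  rw [oddExt_neg] at this
  omega

theorem winding_monotone (hw : InX w) : Monotone (oddExt (winding w⁻¹)) :=
  Letter.monotone_of_covBy fun a b h => by
    have := oddExt_winding_sub w⁻¹ hw.inv_pos h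
    split_ifs at this <;> omega

/-- If `w⁻¹` reverses `b < a`, then the winding function increases from `b` to `a`. -/
theorem winding_lt (hw : InX w) {a b : Letter n} (hab : b < a)
    (h : (w⁻¹).1 a < (w⁻¹).1 b) : oddExt (winding w⁻¹) b < oddExt (winding w⁻¹) a := by
  have hm := winding_monotone hw
  refine lt_of_le_of_ne (hm hab.le) fun he => ?_
  -- This pair increases at every covering step: at a descent of `w⁻¹` the winding rises, elsewhere
  -- `w⁻¹` does. Equal winding at `b` and `a` would then force `w⁻¹` to increase from `b` to `a`.
  let f : Letter n → ℤ ×ₗ Letter n := fun c => toLex (oddExt (winding w⁻¹) c, (w⁻¹).1 c)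
  have hf : StrictMono f := Letter.strictMono_of_covBy fun c d hcd => by
    have := oddExt_winding_sub w⁻¹ hw.inv_pos hcd
    rw [Prod.Lex.toLex_lt_toLex]
    split_ifs at this with h1
    · exact Or.inl (by simp only; omega)
    · refine Or.inr ⟨by simp only; omega, lt_of_le_of_ne (not_lt.1 h1) fun h2 => ?_⟩
      exact hcd.1.ne ((w⁻¹).1.injective h2)
  have := hf hab
  rw [Prod.Lex.toLex_lt_toLex] at this
  rcases this with h1 | ⟨-, h1⟩
  · exact h1.ne he
  · exact lt_asymm h h1

/-- Recovers `w` from the folded values. Where `z` ties there is no big ascent, so `w a` and `w b`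
either form a covering pair with equal winding or are reversed, in which case the winding is larger
at `w a`. -/
theorem sortKey_strictMono (hw : InX w) (hz : z ∈ simplexPoints hn w r) :
    StrictMono (sortKey (fun a => oddExt z ((w⁻¹).1 a)) (oddExt (winding w⁻¹)) ∘ w.1) := by
  refine Letter.strictMono_of_covBy fun a b hab => ?_
  simp only [Function.comp_apply, sortKey_lt_iff, SignedPerm.inv_apply_apply]
  obtain ⟨h1, h2⟩ := hz.1 a b hab
  rcases h1.lt_or_eq with h1 | h1
  · exact Or.inl h1
  refine Or.inr ⟨h1, ?_⟩
  have hml : ¬ MuchLess (w.1 a) (w.1 b) := fun h => (h2 h).ne h1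
  rcases lt_trichotomy (w.1 a) (w.1 b) with h3 | h3 | h3
  · refine Or.inr ⟨?_, h3⟩
    have := oddExt_winding_sub w⁻¹ hw.inv_pos (covBy_of_not_muchLess hml h3)
    rw [SignedPerm.inv_apply_apply, SignedPerm.inv_apply_apply, if_neg hab.1.not_gt] at this
    omega
  · exact absurd (w.1.injective h3) hab.1.ne
  · exact Or.inl (winding_lt hw h3 (by simpa using hab.1))

theorem isReduction_foldPoint (hr : 1 ≤ r) (hw : InX w) (hz : z ∈ simplexPoints hn w r)
    (a : Letter n) :
    IsReduction r (oddExt (foldPoint w r z) a) (oddExt z ((w⁻¹).1 a))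
      (oddExt (winding w⁻¹) a) := by
  -- A value `r` forces the top of the chain to be `r`, so there is no big ascent at `n`. Then `w(n)
  -- > 0`, since the other possibility `w(n) = -1` contradicts `w ∈ X_n`. As `w(n)` is sorted last,
  -- it has the least winding among letters of value `r`, and that winding is nonnegative.
  have key : ∀ a : Letter n, oddExt z ((w⁻¹).1 a) = r → 0 ≤ oddExt (winding w⁻¹) a := by
    intro a ha
    have htop : oddExt z (Letter.last hn) = r := by
      refine le_antisymm (simplexPoints_le hz _) ?_
      rw [← ha]
      exact simplexPoints_monotone hz (Letter.le_last hn _)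
    have hml : ¬ MuchLess (w.1 (Letter.last hn)) (Letter.neg (w.1 (Letter.last hn))) :=
      fun h => (hz.2.2 h).ne htop
    have hpos : 0 < (w.1 (Letter.last hn)).1 := by
      by_contra hc
      have h0 := (w.1 (Letter.last hn)).2
      have h1 := covBy_of_not_muchLess hml (by rw [Letter.lt_iff_val, Letter.neg_val]; omega)
      rw [Letter.covBy_iff, Letter.neg_val] at h1
      have h2 : w.1 (Letter.last hn) = Letter.neg (Letter.pos ⟨0, hn⟩) :=
        Subtype.ext (by simp; omega)
      have h3 := hw.inv_pos ⟨0, hn⟩ rfl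
      rw [← Letter.neg_neg (Letter.pos _), ← h2, SignedPerm.apply_neg,
        SignedPerm.inv_apply_apply] at h3
      simp at h3
      omega
    have hwl : 0 ≤ oddExt (winding w⁻¹) (w.1 (Letter.last hn)) :=
      oddExt_nonneg (oddExt_neg _) (winding_monotone hw) hpos
    have hk := (sortKey_strictMono hw hz).monotone (Letter.le_last hn ((w⁻¹).1 a))
    simp only [Function.comp_apply, SignedPerm.apply_inv_apply] at hk
    have hk' := not_lt.2 hk
    rw [sortKey_lt_iff, SignedPerm.inv_apply_apply, ha, htop] at hk'
    by_contra hc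
    exact hk' (Or.inr ⟨rfl, Or.inl (by omega)⟩)
  refine ⟨oddExt_foldPoint w r z a, simplexPoints_ge hz _, simplexPoints_le hz _, fun h => ?_,
    fun h => ?_⟩
  · rw [oddExt_foldPoint, h]
    have := mul_nonneg (by positivity : (0 : ℤ) ≤ 2 * r) (key a h)
    omega
  · have h1 : oddExt z ((w⁻¹).1 (Letter.neg a)) = r := by
      rw [SignedPerm.apply_neg, oddExt_neg, h]; ring
    have h2 := key _ h1
    rw [oddExt_neg] at h2
    rw [oddExt_foldPoint, h]
    have := mul_nonneg (by positivity : (0 : ℤ) ≤ 2 * r) h2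
    rw [mul_neg] at this
    omega

/-- Chain values lie in `[-r, r]`. Off the descents of `w⁻¹` their difference is already in `[0,
2r]`; at a descent it lies in `[-2r, 0]` and the winding lifts it by `2r`. -/
theorem foldPoint_sub (hw : InX w) (hz : z ∈ simplexPoints hn w r) {a b : Letter n}
    (h : a ⋖ b) : 0 ≤ oddExt (foldPoint w r z) b - oddExt (foldPoint w r z) a ∧
      oddExt (foldPoint w r z) b - oddExt (foldPoint w r z) a ≤ 2 * r := by
  have h1 := oddExt_winding_sub w⁻¹ hw.inv_pos h
  have h2 : oddExt (foldPoint w r z) b - oddExt (foldPoint w r z) a =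
      oddExt z ((w⁻¹).1 b) - oddExt z ((w⁻¹).1 a) +
        2 * r * (oddExt (winding w⁻¹) b - oddExt (winding w⁻¹) a) := by
    rw [oddExt_foldPoint, oddExt_foldPoint]; ring
  have ha1 := simplexPoints_le hz ((w⁻¹).1 a)
  have ha2 := simplexPoints_ge hz ((w⁻¹).1 a)
  have hb1 := simplexPoints_le hz ((w⁻¹).1 b)
  have hb2 := simplexPoints_ge hz ((w⁻¹).1 b)
  rw [h2, h1]
  split_ifs with h3
  · have := simplexPoints_monotone hz h3.le
    omega
  · have := simplexPoints_monotone hz (not_lt.1 h3)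
    omega

/-- Write `y(n) = p + 2rm`. The sign of `w⁻¹(n)` gives both the weak sign of `p` and the parity of
`cdes w⁻¹`. For the strict lower bound, comparing the keys of `n` and `-n` excludes `p = 0` in odd
slabs other than the first, and the sign rule excludes `p = -r` in even slabs. -/
theorem inSlab_foldPoint (hr : 1 ≤ r) (hw : InX w) (hz : z ∈ simplexPoints hn w r) :
    1 ≤ cdes w⁻¹ ∧ InSlab (cdes w⁻¹) r (oddExt (foldPoint w r z) (Letter.last hn)) := by
  have hc := cdes_eq hn w⁻¹ hw.inv_pos
  have hred := isReduction_foldPoint hr hw hz (Letter.last hn)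
  have hmono : Monotone (oddExt (foldPoint w r z)) := Letter.monotone_of_covBy fun a b h => by
    have := foldPoint_sub hw hz h; omega
  have hy0 : 0 ≤ oddExt (foldPoint w r z) (Letter.last hn) :=
    oddExt_nonneg (oddExt_neg _) hmono (by simp; omega)
  have hm0 : 0 ≤ oddExt (winding w⁻¹) (Letter.last hn) :=
    oddExt_nonneg (oddExt_neg _) (winding_monotone hw) (by simp; omega)
  have hkey : ∀ a b, (w⁻¹).1 a < (w⁻¹).1 b → _ := fun a b h => sortKey_strictMono hw hz h
  simp only [Function.comp_apply, SignedPerm.apply_inv_apply, sortKey_lt_iff] at hkey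
  set y := oddExt (foldPoint w r z) (Letter.last hn) with hy
  set m := oddExt (winding w⁻¹) (Letter.last hn) with hm
  set p := oddExt z ((w⁻¹).1 (Letter.last hn)) with hp
  have hne := ((w⁻¹).1 (Letter.last hn)).2.1
  have e := hred.eq
  have hple := hred.le
  have hpge := hred.ge
  have hval : ((Letter.neg (Letter.last hn)).1 : ℤ) = -n := rfl
  by_cases hpos : 0 < ((w⁻¹).1 (Letter.last hn)).1
  · rw [if_pos hpos] at hc
    have hp0 : 0 ≤ p := oddExt_nonneg (oddExt_neg _) (simplexPoints_monotone hz) hpos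
    have h1 := hkey (Letter.neg (Letter.last hn)) (Letter.last hn) (by
      rw [SignedPerm.apply_neg, Letter.lt_iff_val, Letter.neg_val]; omega)
    rw [SignedPerm.apply_neg, oddExt_neg, oddExt_neg, ← hp, ← hm] at h1
    refine ⟨by omega, ?_, ?_⟩
    · split_ifs with h2
      · exact hy0
      · rw [hc, e]
        have : p ≠ 0 := by
          intro h0
          rw [h0] at h1
          omega
        have : (1 + 2 * m - 1) * (r : ℤ) = 2 * r * m := by ring
        omega
    · rw [hc, e]
      have : (1 + 2 * m) * (r : ℤ) = r + 2 * r * m := by ring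
      omega
  · rw [if_neg hpos] at hc
    have hp0 : 0 ≤ -p := by
      rw [hp, ← oddExt_neg]
      exact oddExt_nonneg (oddExt_neg _) (simplexPoints_monotone hz) (by rw [Letter.neg_val]; omega)
    have h1 := hkey (Letter.last hn) (Letter.neg (Letter.last hn)) (by
      rw [SignedPerm.apply_neg, Letter.lt_iff_val, Letter.neg_val]; omega)
    rw [SignedPerm.apply_neg, oddExt_neg, oddExt_neg, ← hp, ← hm, Letter.lt_iff_val, hval,
      Letter.last_val] at h1
    have hm1 : m ≠ 0 := by
      intro h0
      rw [h0] at e h1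
      omega
    have hk1 : cdes w⁻¹ ≠ 1 := by omega
    have hpr : p ≠ -r := fun h => by have := hred.neg h; omega
    refine ⟨by omega, ?_, ?_⟩
    · rw [if_neg hk1, hc, e]
      have : (0 + 2 * m - 1) * (r : ℤ) = 2 * r * m - r := by ring
      omega
    · rw [hc, e]
      have : (0 + 2 * m) * (r : ℤ) = 2 * r * m := by ring
      omega

end forward

end bijection

/-! ### The folding map is a bijection -/

section counting

variable {n : ℕ}

theorem exists_foldPoint_eq {hn : 1 ≤ n} {k r : ℕ} (hk : 1 ≤ k) (hr : 1 ≤ r) {y : Fin n → ℤ}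
    (hy : y ∈ hypersimplexPoints hn k r) :
    ∃ w : SignedPerm n, InX w ∧ cdes w⁻¹ = k ∧ ∃ z ∈ simplexPoints hn w r,
      foldPoint w r z = y := by
  choose p m hpm using fun i => exists_isReduction hr (y i)
  have hred := IsReduction.oddExt hpm
  obtain ⟨w, hw⟩ := exists_signedPerm_strictMono (oddExt_neg p) (oddExt_neg m)
  have hkey : ∀ a b, (w⁻¹).1 a < (w⁻¹).1 b → _ := fun a b h => hw h
  simp only [Function.comp_apply, SignedPerm.apply_inv_apply, sortKey_lt_iff] at hkey
  have hmono : Monotone (oddExt y) := Letter.monotone_of_covBy fun a b h => by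
    have := hy.1 a b h; omega
  have hr' : (1 : ℤ) ≤ r := by exact_mod_cast hr
  have hX : InX w := by
    intro a ha
    -- The pair `-1 ⋖ 1` gives `0 ≤ y_1 ≤ r`, so the quotient at the letter `1` vanishes and `p_1 =
    -- y_1 ≥ 0`.
    have hm0 : -1 < (m : Fin n → ℤ) ⟨0, hn⟩ ∧ m ⟨0, hn⟩ < 1 ∧ 0 ≤ y ⟨0, hn⟩ := by
      have h1 := hy.1 _ _ (Letter.neg_pos_covBy_pos (i := (⟨0, hn⟩ : Fin n)) rfl)
      rw [oddExt_neg, oddExt_pos] at h1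
      have h2 := hpm ⟨0, hn⟩
      have e := h2.eq
      have hge := h2.ge
      have hle := h2.le
      have hneg := h2.neg
      refine ⟨?_, ?_, by omega⟩
      · by_contra hc
        have : (2 * r : ℤ) * m ⟨0, hn⟩ ≤ 2 * r * (-1) := by gcongr; omega
        omega
      · by_contra hc
        have : (2 * r : ℤ) * 1 ≤ 2 * r * m ⟨0, hn⟩ := by gcongr; omega
        omega
    have hm1 : m ⟨0, hn⟩ = 0 := by omega
    have e := (hpm ⟨0, hn⟩).eq
    rw [hm1] at e
    have ha' : a = Letter.pos ⟨0, hn⟩ := Subtype.ext (by simp [ha])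
    have hne := ((w⁻¹).1 a).2.1
    by_contra hc
    have h1 := hkey a (Letter.neg a) (by
      rw [SignedPerm.apply_neg, Letter.lt_iff_val, Letter.neg_val]; omega)
    rw [oddExt_neg, oddExt_neg, ha', oddExt_pos, oddExt_pos, hm1, Letter.lt_iff_val,
      Letter.neg_val, Letter.pos_val] at h1
    simp only [CharP.cast_eq_zero] at h1
    omega
  have hstep : ∀ a b, a ⋖ b →
      oddExt m b - oddExt m a = if (w⁻¹).1 b < (w⁻¹).1 a then 1 else 0 := by
    intro a b hab
    have hy1 := hy.1 a b hab
    have ha := hred a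
    have hb := hred b
    have e : oddExt y b - oddExt y a =
        oddExt p b - oddExt p a + 2 * r * (oddExt m b - oddExt m a) := by
      rw [ha.eq, hb.eq]; ring
    have ha1 := ha.le
    have ha2 := ha.ge
    have ha3 := ha.pos
    have ha4 := ha.neg
    have hb1 := hb.le
    have hb2 := hb.ge
    have hb3 := hb.pos
    have hb4 := hb.neg
    have hlt := hab.1
    set d := oddExt m b - oddExt m a with hd
    -- A priori `d` lies between `-1` and `2`. The extremes need `p a` and `p b` at opposite ends
    -- `±r`, where the sign rule contradicts the monotonicity of `y`; the sort order decides between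
    -- `0` and `1`.
    split_ifs with h
    · have h1 := hkey b a h
      rcases lt_trichotomy d 1 with h2 | h2 | h2
      · have : (2 * r : ℤ) * d ≤ 2 * r * 0 := by gcongr; omega
        have h3 : ¬ b < a := hlt.not_gt
        simp only [h3, and_false, or_false] at h1
        omega
      · exact h2
      · have : (2 * r : ℤ) * 2 ≤ 2 * r * d := by gcongr; omega
        omega
    · have hne : (w⁻¹).1 a ≠ (w⁻¹).1 b := fun h' => hlt.ne ((w⁻¹).1.injective h')
      have h1 := hkey a b (lt_of_le_of_ne (not_lt.1 h) hne)
      rcases lt_trichotomy d 0 with h2 | h2 | h2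
      · have : (2 * r : ℤ) * d ≤ 2 * r * (-1) := by gcongr; omega
        omega
      · exact h2
      · have : (2 * r : ℤ) * 1 ≤ 2 * r * d := by gcongr; omega
        omega
  have hwind : oddExt m = oddExt (winding w⁻¹) :=
    odd_eq_of_covBy (oddExt_neg _) (oddExt_neg _) fun a b hab => by
      rw [hstep a b hab, oddExt_winding_sub w⁻¹ hX.inv_pos hab]
  let z : Fin n → ℤ := fun i => oddExt p (w.1 (Letter.pos i))
  have hz : ∀ a, oddExt z a = oddExt p (w.1 a) := by
    intro a
    have := eq_oddExt (f := fun a => oddExt p (w.1 a)) (fun a => by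
      rw [SignedPerm.apply_neg, oddExt_neg])
    exact (congrFun this a).symm
  have hzmem : z ∈ simplexPoints hn w r := by
    refine ⟨fun a b hab => ?_, ?_, fun hml => ?_⟩
    · have h1 := hw hab.1
      simp only [Function.comp_apply, sortKey_lt_iff] at h1
      rw [hz, hz]
      refine ⟨by omega, fun hml => ?_⟩
      rcases h1 with h1 | ⟨h1, h2⟩
      · exact h1
      -- If `p` ties at a big ascent, monotonicity of `y` and the sort order force equal `m`, so `y`
      -- is constant from `w a` to `w b`. A letter strictly between then has the same `p` and `m`,
      -- hence is sorted strictly between, against `a ⋖ b`.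
      exfalso
      have hlt := hml.lt
      have h3 := hmono hlt.le
      have h4 := (hred (w.1 a)).eq
      have h5 := (hred (w.1 b)).eq
      rcases h2 with h2 | ⟨h2, -⟩
      · have : (2 * r : ℤ) * oddExt m (w.1 b) < 2 * r * oddExt m (w.1 a) := by gcongr
        omega
      obtain ⟨c, hc1, hc2⟩ := hml
      replace hc1 : w.1 a < c := hc1
      replace hc2 : c < w.1 b := hc2
      have hyab : oddExt y (w.1 a) = oddExt y (w.1 b) := by rw [h4, h5, h1, h2]
      have hyc : oddExt y c = oddExt y (w.1 a) :=
        le_antisymm (by rw [hyab]; exact hmono hc2.le) (hmono hc1.le)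
      have hrc := hred c
      rw [hyc] at hrc
      obtain ⟨u1, u2⟩ := hrc.unique hr (hred (w.1 a))
      have g1 : a < (w⁻¹).1 c := by
        have : sortKey (oddExt p) (oddExt m) (w.1 a) <
            sortKey (oddExt p) (oddExt m) (w.1 ((w⁻¹).1 c)) := by
          rw [SignedPerm.apply_inv_apply, sortKey_lt_iff]
          exact Or.inr ⟨u1.symm, Or.inr ⟨u2.symm, hc1⟩⟩
        exact hw.lt_iff_lt.1 this
      have g2 : (w⁻¹).1 c < b := by
        have : sortKey (oddExt p) (oddExt m) (w.1 ((w⁻¹).1 c)) <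
            sortKey (oddExt p) (oddExt m) (w.1 b) := by
          rw [SignedPerm.apply_inv_apply, sortKey_lt_iff]
          exact Or.inr ⟨u1.trans h1, Or.inr ⟨u2.trans h2, hc2⟩⟩
        exact hw.lt_iff_lt.1 this
      exact hab.2 g1 g2
    · rw [hz]
      exact (hred _).le
    · rw [hz]
      -- Remainder `r` needs `y > 0` at `w(n)`, but a big ascent at `n` makes `w(n)` negative.
      refine lt_of_le_of_ne (hred _).le fun he => ?_
      have h1 := (hred _).pos he
      have h2 := hml.lt
      rw [Letter.lt_iff_val, Letter.neg_val] at h2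
      have h3 := oddExt_nonneg (oddExt_neg y) hmono (a := Letter.neg (w.1 (Letter.last hn)))
        (by rw [Letter.neg_val]; omega)
      rw [oddExt_neg] at h3
      omega
  have hfold : foldPoint w r z = y := by
    apply oddExt_injective
    funext a
    rw [oddExt_foldPoint, hz, SignedPerm.apply_inv_apply, ← hwind]
    exact (hred a).eq.symm
  -- The point lies in slab `cdes w⁻¹` and in slab `k`; slabs are disjoint.
  obtain ⟨h1, h2⟩ := inSlab_foldPoint hr hX hzmem
  rw [hfold] at h2
  exact ⟨w, hX, h2.unique h1 hk hy.2, z, hzmem, hfold⟩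

theorem foldPoint_mem {hn : 1 ≤ n} {r : ℕ} (hr : 1 ≤ r) {w : SignedPerm n} (hw : InX w)
    {z : Fin n → ℤ} (hz : z ∈ simplexPoints hn w r) :
    foldPoint w r z ∈ hypersimplexPoints hn (cdes w⁻¹) r :=
  ⟨fun _ _ h => foldPoint_sub hw hz h, (inSlab_foldPoint hr hw hz).2⟩

/-- The point determines its reduction `(p, m)`, this determines `w` as the sorting permutation, and
then `z = p ∘ w`. -/
theorem foldPoint_inj {hn : 1 ≤ n} {r : ℕ} (hr : 1 ≤ r) {w w' : SignedPerm n} (hw : InX w)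
    (hw' : InX w') {z z' : Fin n → ℤ} (hz : z ∈ simplexPoints hn w r)
    (hz' : z' ∈ simplexPoints hn w' r) (h : foldPoint w r z = foldPoint w' r z') :
    w = w' ∧ z = z' := by
  have hu : ∀ a, _ := fun a => by
    have h1 := isReduction_foldPoint hr hw hz a
    rw [h] at h1
    exact h1.unique hr (isReduction_foldPoint hr hw' hz' a)
  have hP : (fun a => oddExt z ((w⁻¹).1 a)) = fun a => oddExt z' ((w'⁻¹).1 a) :=
    funext fun a => (hu a).1
  have hM : oddExt (winding w⁻¹) = oddExt (winding w'⁻¹) := funext fun a => (hu a).2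
  have hs := sortKey_strictMono hw hz
  rw [hP, hM] at hs
  obtain rfl : w = w' := Subtype.ext (perm_eq_of_strictMono hs (sortKey_strictMono hw' hz'))
  refine ⟨rfl, oddExt_injective (funext fun a => ?_)⟩
  have := congrFun hP (w.1 a)
  simpa using this

end counting

section chains

variable {n : ℕ}

/-! ### Counting lattice points of half-open simplices -/

/-- Integer chains `0 ≤ z_1 ≤ ⋯ ≤ z_n ≤ r` with prescribed minimal gaps `s` between consecutive
terms. -/
def gappedChains (n : ℕ) (s : ℕ → ℕ) (r : ℕ) : Set (Fin n → ℤ) :=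
  {z | (∀ i : Fin n, (i : ℕ) = 0 → (s 0 : ℤ) ≤ z i) ∧
    (∀ i j : Fin n, (j : ℕ) = i + 1 → z i + s j ≤ z j) ∧
    ∀ i : Fin n, (i : ℕ) + 1 = n → z i + s n ≤ r}

theorem card_gappedChains (hn : 1 ≤ n) (s : ℕ → ℕ) (r : ℕ)
    (hs : ∑ j ∈ Finset.range (n + 1), s j ≤ r + n) :
    (gappedChains n s r).Finite ∧ (gappedChains n s r).ncard =
      (r + n - ∑ j ∈ Finset.range (n + 1), s j).choose n := by
  obtain ⟨N, hN⟩ := Nat.exists_eq_add_of_le hs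
  rw [hN, Nat.add_sub_cancel_left]
  obtain ⟨n, rfl⟩ : ∃ n', n = n' + 1 := ⟨n - 1, by omega⟩
  -- Removing the accumulated gaps and adding `i` turns a gapped chain into a strictly increasing
  -- sequence in `[0, N)`, that is, a subset of that interval.
  let t : ℕ → ℤ := fun i => (i : ℤ) - (∑ j ∈ Finset.range (i + 1), s j : ℕ)
  have ht0 : t 0 = -(s 0 : ℤ) := by simp [t]
  have ht : ∀ i, t (i + 1) = t i + 1 - s (i + 1) := by
    intro i
    simp only [t]
    rw [Finset.sum_range_succ _ (i + 1)]
    push_cast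
    ring
  have htn : t n + r + 1 - s (n + 1) = N := by
    have := ht n
    simp only [t] at this ⊢
    omega
  have hmono : ∀ z ∈ gappedChains (n + 1) s r, StrictMono fun i : Fin (n + 1) => z i + t i := by
    intro z hz
    refine Fin.strictMono_iff_lt_succ.2 fun i => ?_
    have h1 := hz.2.1 i.castSucc i.succ (by simp)
    have h2 := ht i
    simp only [Fin.val_succ, Fin.val_castSucc] at h1 ⊢
    omega
  let f : (Fin (n + 1) → ℤ) → Finset ℤ := fun z => Finset.univ.image fun i => z i + t i
  have hinj : Set.InjOn f (gappedChains (n + 1) s r) := by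
    intro z hz z' hz' h
    have h1 : Set.range (fun i : Fin (n + 1) => z i + t i) =
        Set.range (fun i : Fin (n + 1) => z' i + t i) := by
      have := congrArg (fun u : Finset ℤ => (u : Set ℤ)) h
      simpa [f] using this
    have h2 := ((hmono z hz).range_inj (hmono z' hz')).1 h1
    funext i
    have := congrFun h2 i
    simpa using this
  have himg : f '' gappedChains (n + 1) s r =
      (Finset.powersetCard (n + 1) (Finset.Ico (0 : ℤ) N) : Set (Finset ℤ)) := by
    ext u
    simp only [Set.mem_image, Finset.mem_coe, Finset.mem_powersetCard]
    constructor
    · rintro ⟨z, hz, rfl⟩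
      refine ⟨?_, ?_⟩
      · intro v hv
        obtain ⟨i, -, rfl⟩ := Finset.mem_image.1 hv
        have h1 := (hmono z hz).monotone (Fin.zero_le i)
        have h2 := (hmono z hz).monotone (Fin.le_last i)
        have h3 := hz.1 0 rfl
        have h4 := hz.2.2 (Fin.last n) (by simp)
        simp only [Fin.val_zero, Fin.val_last] at h1 h2
        rw [Finset.mem_Ico]
        omega
      · rw [Finset.card_image_of_injective _ (hmono z hz).injective, Finset.card_univ,
          Fintype.card_fin]
    · rintro ⟨hu, hc⟩
      let e := u.orderEmbOfFin hc
      have he : ∀ i, 0 ≤ e i ∧ e i < N := fun i =>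
        Finset.mem_Ico.1 (hu (Finset.orderEmbOfFin_mem u hc i))
      refine ⟨fun i => e i - t i, ⟨fun i hi => ?_, fun i j hij => ?_, fun i hi => ?_⟩, ?_⟩
      · have := he i
        simp only [hi]
        omega
      · have h1 : e i < e j := e.strictMono (Fin.lt_def.2 (by omega))
        have h2 := ht i
        rw [← hij] at h2
        simp only
        omega
      · have := he i
        have hi' : (i : ℕ) = n := by omega
        simp only [hi']
        omega
      · simp only [f, sub_add_cancel]
        exact Finset.image_orderEmbOfFin_univ u hc
  refine ⟨Set.Finite.of_finite_image (himg ▸ Finset.finite_toSet _) hinj, ?_⟩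
  rw [← hinj.ncard_image, himg, Set.ncard_coe_finset, Finset.card_powersetCard,
    Int.card_Ico]
  simp

open Classical in
/-- `1` if `w` has a big ascent at position `j` (at position `-1` for `j = 0`), and `0`
otherwise. -/
noncomputable def bigAscentGap (w : SignedPerm n) (j : ℕ) : ℕ :=
  if ∃ a : Letter n, (a.1 = -1 ∨ 0 < a.1) ∧ a.1.toNat = j ∧ MuchLess (w.1 a) (w.1 (Letter.succ a))
  then 1 else 0

theorem bigAscentGap_eq (w : SignedPerm n) {a : Letter n} (ha : a.1 = -1 ∨ 0 < a.1) {j : ℕ}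
    (hj : a.1.toNat = j) :
    bigAscentGap w j = if MuchLess (w.1 a) (w.1 (Letter.succ a)) then 1 else 0 := by
  rw [bigAscentGap]
  congr 1
  refine propext ⟨?_, fun h => ⟨a, ha, hj, h⟩⟩
  rintro ⟨b, hb, hbj, h⟩
  obtain rfl : b = a := Subtype.ext (by omega)
  exact h

/-- `Int.toNat` sends the position `-1` to `0` and fixes the others, so the positions are indexed by
`0, …, n`. -/
theorem sum_bigAscentGap (w : SignedPerm n) :
    ∑ j ∈ Finset.range (n + 1), bigAscentGap w j = basc w := by
  classical
  simp only [bigAscentGap]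
  rw [← Finset.card_filter, basc]
  symm
  refine Finset.card_bij (fun a _ => a.1.toNat) ?_ ?_ ?_
  · intro a ha
    simp only [Finset.mem_filter, Finset.mem_univ, true_and] at ha
    simp only [Finset.mem_filter, Finset.mem_range]
    have := a.2
    exact ⟨by omega, a, ha.1, rfl, ha.2⟩
  · intro a ha b hb hab
    simp only [Finset.mem_filter, Finset.mem_univ, true_and] at ha hb
    exact Subtype.ext (by omega)
  · intro j hj
    simp only [Finset.mem_filter, Finset.mem_range] at hj
    obtain ⟨-, a, ha, haj, h⟩ := hj
    exact ⟨a, by simp only [Finset.mem_filter, Finset.mem_univ, true_and]; exact ⟨ha, h⟩, haj⟩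

theorem simplexPoints_eq_gappedChains (hn : 1 ≤ n) (w : SignedPerm n) (r : ℕ) :
    simplexPoints hn w r = gappedChains n (bigAscentGap w) r := by
  have hzero : ∀ i : Fin n, (i : ℕ) = 0 → bigAscentGap w 0 =
      if MuchLess (w.1 (Letter.neg (Letter.pos i))) (w.1 (Letter.pos i)) then 1 else 0 := by
    intro i hi
    rw [bigAscentGap_eq w (a := Letter.neg (Letter.pos i)) (by simp; omega) (by simp),
      Letter.succ_eq_of_covBy (Letter.neg_pos_covBy_pos hi)]
  have hsucc : ∀ i j : Fin n, (j : ℕ) = i + 1 → bigAscentGap w j =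
      if MuchLess (w.1 (Letter.pos i)) (w.1 (Letter.pos j)) then 1 else 0 := by
    intro i j hij
    rw [bigAscentGap_eq w (a := Letter.pos i) (by simp) (by simp; omega),
      Letter.succ_eq_of_covBy (Letter.pos_covBy_pos hij)]
  have hlast : bigAscentGap w n =
      if MuchLess (w.1 (Letter.last hn)) (Letter.neg (w.1 (Letter.last hn))) then 1 else 0 := by
    rw [bigAscentGap_eq w (a := Letter.last hn) (by simp; omega) (by simp),
      Letter.succ_last, SignedPerm.apply_neg]
  have hpl : ∀ i : Fin n, (i : ℕ) + 1 = n → Letter.last hn = Letter.pos i := fun i hi =>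
    Subtype.ext (by simp; omega)
  ext z
  constructor
  · rintro ⟨h1, h2, h3⟩
    refine ⟨fun i hi => ?_, fun i j hij => ?_, fun i hi => ?_⟩
    · have h := h1 _ _ (Letter.neg_pos_covBy_pos hi)
      rw [oddExt_neg, oddExt_pos] at h
      rw [hzero i hi]
      split_ifs with hm
      · have := h.2 hm; push_cast; omega
      · push_cast; omega
    · have h := h1 _ _ (Letter.pos_covBy_pos hij)
      rw [oddExt_pos, oddExt_pos] at h
      rw [hsucc i j hij]
      split_ifs with hm
      · have := h.2 hm; push_cast; omega
      · push_cast; omega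
    · rw [hlast]
      split_ifs with hm
      · have h := h3 hm
        rw [hpl i hi, oddExt_pos] at h
        push_cast; omega
      · rw [hpl i hi, oddExt_pos] at h2
        push_cast; omega
  · rintro ⟨h1, h2, h3⟩
    have h3' := h3 ⟨n - 1, by omega⟩ (by simp; omega)
    have hpl' := hpl ⟨n - 1, by omega⟩ (by simp; omega)
    refine ⟨fun a b hab => ?_, ?_, fun hm => ?_⟩
    · rcases Letter.covBy_cases hab with ⟨i, hi, rfl, rfl⟩ | ⟨i, j, hij, rfl, rfl⟩ |
        ⟨i, j, hij, rfl, rfl⟩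
      · have h := h1 i hi
        rw [hzero i hi] at h
        rw [oddExt_neg, oddExt_pos]
        refine ⟨by split_ifs at h <;> push_cast at h <;> omega, fun hm => ?_⟩
        rw [if_pos hm] at h
        push_cast at h; omega
      · have h := h2 i j hij
        rw [hsucc i j hij] at h
        rw [oddExt_pos, oddExt_pos]
        refine ⟨by split_ifs at h <;> push_cast at h <;> omega, fun hm => ?_⟩
        rw [if_pos hm] at h
        push_cast at h; omega
      · have h := h2 i j hij
        rw [hsucc i j hij] at h
        rw [oddExt_neg, oddExt_neg, oddExt_pos, oddExt_pos]
        refine ⟨by split_ifs at h <;> push_cast at h <;> omega, fun hm => ?_⟩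
        rw [SignedPerm.apply_neg, SignedPerm.apply_neg] at hm
        have hm' := hm.neg
        rw [Letter.neg_neg, Letter.neg_neg] at hm'
        rw [if_pos hm'] at h
        push_cast at h; omega
    · rw [hlast] at h3'
      rw [hpl', oddExt_pos]
      split_ifs at h3' <;> push_cast at h3' <;> omega
    · rw [hlast, if_pos hm] at h3'
      rw [hpl', oddExt_pos]
      push_cast at h3'; omega

/-- If all `n + 1` positions were big ascents, `w` would be increasing and yet satisfy `w(n) <
w(-n)`. The bound keeps `r + n - basc w` from truncating. -/
theorem basc_le (hn : 1 ≤ n) (w : SignedPerm n) : basc w ≤ n := by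
  have hle : ∀ j, bigAscentGap w j ≤ 1 := fun j => by
    rw [bigAscentGap]; split_ifs <;> omega
  by_contra hc
  have hall : ∀ a : Letter n, (a.1 = -1 ∨ 0 < a.1) →
      MuchLess (w.1 a) (w.1 (Letter.succ a)) := by
    intro a ha
    by_contra hm
    have hlt : ∑ j ∈ Finset.range (n + 1), bigAscentGap w j <
        ∑ j ∈ Finset.range (n + 1), 1 := by
      refine Finset.sum_lt_sum (fun j _ => hle j) ⟨a.1.toNat, ?_, ?_⟩
      · rw [Finset.mem_range]
        have := a.2
        omega
      · rw [bigAscentGap_eq w ha rfl, if_neg hm]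
        exact one_pos
    rw [sum_bigAscentGap] at hlt
    simp at hlt
    omega
  have hmono : StrictMono w.1 := Letter.strictMono_of_covBy fun a b hab => by
    rcases Letter.covBy_cases hab with ⟨i, hi, rfl, rfl⟩ | ⟨i, j, hij, rfl, rfl⟩ |
      ⟨i, j, hij, rfl, rfl⟩
    · have := (hall (Letter.neg (Letter.pos i)) (by simp; omega)).lt
      rwa [Letter.succ_eq_of_covBy hab] at this
    · rw [← Letter.succ_eq_of_covBy hab]
      exact (hall (Letter.pos i) (by simp)).lt
    · rw [SignedPerm.apply_neg, SignedPerm.apply_neg, Letter.neg_lt_neg,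
        ← Letter.succ_eq_of_covBy (Letter.pos_covBy_pos hij)]
      exact (hall (Letter.pos i) (by simp)).lt
  have h1 := (hall (Letter.last hn) (by simp; omega)).lt
  rw [Letter.succ_last] at h1
  exact lt_asymm h1 (hmono (by rw [Letter.lt_iff_val]; simp; omega))

theorem card_simplexPoints (hn : 1 ≤ n) (w : SignedPerm n) (r : ℕ) :
    (simplexPoints hn w r).Finite ∧
      (simplexPoints hn w r).ncard = (r + n - basc w).choose n := by
  have h := card_gappedChains hn (bigAscentGap w) r (by
    rw [sum_bigAscentGap]
    have := basc_le hn w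
    omega)
  rwa [sum_bigAscentGap, ← simplexPoints_eq_gappedChains hn] at h

theorem card_hypersimplexPoints (hn : 1 ≤ n) {k r : ℕ} (hk : 1 ≤ k) (hr : 1 ≤ r) :
    (hypersimplexPoints hn k r).Finite ∧ (hypersimplexPoints hn k r).ncard =
      ∑ w : SignedPerm n with InX w ∧ cdes w⁻¹ = k, (r + n - basc w).choose n := by
  classical
  have hunion : hypersimplexPoints hn k r =
      ⋃ w ∈ (Finset.univ.filter fun w : SignedPerm n => InX w ∧ cdes w⁻¹ = k),
        foldPoint w r '' simplexPoints hn w r := by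
    ext y
    simp only [Set.mem_iUnion, Finset.mem_filter, Finset.mem_univ, true_and, Set.mem_image,
      exists_prop]
    constructor
    · intro hy
      obtain ⟨w, h1, h2, z, h3, h4⟩ := exists_foldPoint_eq hk hr hy
      exact ⟨w, ⟨h1, h2⟩, z, h3, h4⟩
    · rintro ⟨w, ⟨h1, rfl⟩, z, h3, rfl⟩
      exact foldPoint_mem hr h1 h3
  have hfin : ∀ w : SignedPerm n, (foldPoint w r '' simplexPoints hn w r).Finite := fun w =>
    (card_simplexPoints hn w r).1.image _
  refine ⟨?_, ?_⟩
  · rw [hunion]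
    exact Set.Finite.biUnion (Finset.finite_toSet _) fun w _ => hfin w
  · have hcoe : hypersimplexPoints hn k r =
        ((Finset.univ.filter fun w : SignedPerm n => InX w ∧ cdes w⁻¹ = k).biUnion
          fun w => (hfin w).toFinset : Finset (Fin n → ℤ)) := by
      rw [hunion]; simp
    rw [hcoe, Set.ncard_coe_finset, Finset.card_biUnion]
    · refine Finset.sum_congr rfl fun w hw => ?_
      have hw' := (Finset.mem_filter.1 hw).2.1
      rw [← Set.ncard_eq_toFinset_card _ (hfin w), Set.InjOn.ncard_image,
        (card_simplexPoints hn w r).2]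
      intro z hz z' hz' h
      exact (foldPoint_inj hr hw' hw' hz hz' h).2
    · intro w hw w' hw' hne
      have hw := (Finset.mem_filter.1 hw).2.1
      have hw' := (Finset.mem_filter.1 hw').2.1
      rw [Function.onFun, Finset.disjoint_left]
      intro y hy hy'
      rw [Set.Finite.mem_toFinset] at hy hy'
      obtain ⟨z, hz, rfl⟩ := hy
      obtain ⟨z', hz', h⟩ := hy'
      exact hne (foldPoint_inj hr hw hw' hz hz' h.symm).1

end chains

section ehrhart

variable {n : ℕ}

/-! ### Generating functions -/

/-- The series also uses `r < b`, in particular `r = 0`. There the argument `r - b + 1` is a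
nonpositive integer greater than `-n`, a root of the rising factorial. -/
theorem eval_preHilbertPoly {b : ℕ} (hb : b ≤ n) (r : ℕ) :
    (Polynomial.preHilbertPoly ℚ n b).eval (r : ℚ) = ((r + n - b).choose n : ℕ) := by
  rcases le_or_gt b r with h | h
  · rw [Polynomial.preHilbertPoly_eq_choose_sub_add ℚ n h]
    congr 2
    omega
  · rw [Nat.choose_eq_zero_of_lt (by omega)]
    have h1 : ((r : ℚ) - b + 1) = -((b - r - 1 : ℕ) : ℚ) := by
      rw [Nat.cast_sub (by omega), Nat.cast_sub (by omega)]
      push_cast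
      ring
    simp only [Polynomial.preHilbertPoly, Polynomial.eval_smul, Polynomial.eval_comp,
      Polynomial.eval_add, Polynomial.eval_sub, Polynomial.eval_X, Polynomial.eval_C,
      Polynomial.eval_one, h1]
    rw [ascPochhammer_eval_neg_coe_nat_of_lt (by omega)]
    simp

theorem mk_choose_mul_one_sub_pow {b : ℕ} (hb : b ≤ n) :
    PowerSeries.mk (fun r : ℕ => (((r + n - b).choose n : ℕ) : ℚ)) *
      (1 - PowerSeries.X) ^ (n + 1) = PowerSeries.X ^ b := by
  have h : PowerSeries.mk (fun r : ℕ => (((r + n - b).choose n : ℕ) : ℚ)) =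
      PowerSeries.X ^ b * (PowerSeries.mk 1) ^ (n + 1) := by
    rw [PowerSeries.mk_one_pow_eq_mk_choose_add]
    ext r
    rw [PowerSeries.coeff_mk, PowerSeries.coeff_X_pow_mul']
    split_ifs with hr
    · rw [PowerSeries.coeff_mk]
      congr 2
      omega
    · rw [Nat.choose_eq_zero_of_lt (by omega), Nat.cast_zero]
  rw [h, mul_assoc, ← mul_pow, PowerSeries.mk_one_mul_one_sub_eq_one, one_pow, mul_one]

/-! ### The dimension of the half-open hypersimplex -/

/-- There are at most `n - 1` descents between consecutive positive letters, so the circular descent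
number is at most `1 + 2(n - 1)`. -/
theorem cdes_lt (hn : 1 ≤ n) {w : SignedPerm n} (hw : InX w) : cdes w⁻¹ < 2 * n := by
  have hwind : ∀ m (hm : m < n), winding w⁻¹ ⟨m, hm⟩ ≤ m := by
    intro m
    induction m with
    | zero => intro hm; rw [winding_zero _ rfl]; simp
    | succ m ih =>
      intro hm
      have h1 := ih (by omega)
      rw [winding_succ w⁻¹ (i := ⟨m, by omega⟩) (j := ⟨m + 1, hm⟩) rfl, inversionIndicator]
      split_ifs <;> push_cast <;> omega
  have hc := cdes_eq hn w⁻¹ hw.inv_pos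
  have hl : (Letter.last hn) = Letter.pos ⟨n - 1, by omega⟩ :=
    Subtype.ext (by simp; omega)
  have h1 := hwind (n - 1) (by omega)
  rw [hl, oddExt_pos] at hc
  split_ifs at hc <;> omega

theorem dim_halfOpenHypersimplex (hn : 1 ≤ n) {k : ℕ} (hk : 1 ≤ k) (hk' : k < 2 * n) :
    dim (halfOpenHypersimplex n k) = n := by
  let U : Set (Fin n → ℝ) := {x | (∀ i : Fin n, (i : ℕ) = 0 → 0 < 2 * x i ∧ 2 * x i < 1) ∧
    (∀ i j : Fin n, (j : ℕ) = (i : ℕ) + 1 → 0 < x j - x i ∧ x j - x i < 1) ∧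
    ∀ i : Fin n, (i : ℕ) + 1 = n → (k : ℝ) - 1 < 2 * x i ∧ 2 * x i < k}
  have hopen : IsOpen U := by
    simp only [U, Set.ofPred_and, Set.ofPred_forall]
    refine IsOpen.inter ?_ (IsOpen.inter ?_ ?_)
    · refine isOpen_iInter_of_finite fun i => isOpen_iInter_of_finite fun _ => ?_
      exact (isOpen_lt (by fun_prop) (by fun_prop)).inter (isOpen_lt (by fun_prop) (by fun_prop))
    · refine isOpen_iInter_of_finite fun i => isOpen_iInter_of_finite fun j =>
        isOpen_iInter_of_finite fun _ => ?_
      exact (isOpen_lt (by fun_prop) (by fun_prop)).inter (isOpen_lt (by fun_prop) (by fun_prop))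
    · refine isOpen_iInter_of_finite fun i => isOpen_iInter_of_finite fun _ => ?_
      exact (isOpen_lt (by fun_prop) (by fun_prop)).inter (isOpen_lt (by fun_prop) (by fun_prop))
  have hne : U.Nonempty := by
    have hn' : (1 : ℝ) ≤ n := by exact_mod_cast hn
    have hk1 : (1 : ℝ) ≤ k := by exact_mod_cast hk
    have hk2 : (k : ℝ) + 1 ≤ 2 * n := by exact_mod_cast hk'
    -- The witness has `2x_1` and all gaps equal to `c`, so `2x_n = (2n - 1)c`; `c` places this at
    -- the middle `k - 1/2` of the slab. The bound `c < 1` is where `k < 2n` enters.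
    obtain ⟨c, hc⟩ : ∃ c : ℝ, c = (k - 1 / 2) / (2 * n - 1) := ⟨_, rfl⟩
    have hc0 : 0 < c := by rw [hc]; apply div_pos <;> linarith
    have hc1 : c < 1 := by rw [hc, div_lt_one (by linarith)]; linarith
    have hcn : c * (2 * n - 1) = k - 1 / 2 := by
      rw [hc, div_mul_cancel₀]
      linarith
    refine ⟨fun i => c * (2 * i + 1) / 2, fun i hi => ?_, fun i j hij => ?_, fun i hi => ?_⟩
    · simp only [hi, Nat.cast_zero]
      constructor <;> linarith
    · simp only [hij, Nat.cast_add, Nat.cast_one]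
      constructor <;> linarith
    · have hi' : (i : ℝ) = n - 1 := by
        rw [eq_sub_iff_add_eq]
        exact_mod_cast hi
      simp only [hi']
      have : 2 * (c * (2 * ((n : ℝ) - 1) + 1) / 2) = c * (2 * n - 1) := by ring
      rw [this, hcn]
      constructor <;> linarith
  have hsub : U ⊆ halfOpenHypersimplex n k := by
    rintro x ⟨h1, h2, h3⟩
    refine ⟨⟨fun i hi => ⟨(h1 i hi).1.le, (h1 i hi).2.le⟩,
      fun i j hij => ⟨(h2 i j hij).1.le, (h2 i j hij).2.le⟩⟩, fun i hi => ⟨?_, (h3 i hi).2.le⟩⟩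
    split_ifs with hk1
    · have := (h3 i hi).1
      rw [hk1, Nat.cast_one, sub_self] at this
      exact this.le
    · exact (h3 i hi).1
  have htop : affineSpan ℝ (halfOpenHypersimplex n k) = ⊤ :=
    top_unique ((hopen.affineSpan_eq_top hne).symm.le.trans (affineSpan_mono ℝ hsub))
  rw [dim, ← direction_affineSpan, htop, AffineSubspace.direction_top, finrank_top,
    Module.finrank_fin_fun]

/-! ### Half-integral points of dilates -/

theorem smul_inter_halfLattice (hn : 1 ≤ n) (k : ℕ) {r : ℕ} (hr : 1 ≤ r) :
    ((r : ℝ) • halfOpenHypersimplex n k) ∩ halfLattice n =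
      (fun (y : Fin n → ℤ) (i : Fin n) => (y i : ℝ) / 2) '' hypersimplexPoints hn k r := by
  have hr0 : (0 : ℝ) < r := by exact_mod_cast hr
  have hpl : ∀ i : Fin n, (i : ℕ) + 1 = n → Letter.last hn = Letter.pos i := fun i hi =>
    Subtype.ext (by simp; omega)
  have key : ∀ y : Fin n → ℤ, (fun i => (y i : ℝ) / 2) ∈ (r : ℝ) • halfOpenHypersimplex n k ↔
      y ∈ hypersimplexPoints hn k r := by
    intro y
    rw [Set.mem_smul_set_iff_inv_smul_mem₀ hr0.ne']
    have e1 : ∀ i, 2 * ((r : ℝ)⁻¹ * ((y i : ℝ) / 2)) = y i / r := fun i => by field_simp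
    have e2 : ∀ i j, (r : ℝ)⁻¹ * ((y j : ℝ) / 2) - (r : ℝ)⁻¹ * ((y i : ℝ) / 2) =
        ((y j - y i : ℤ) : ℝ) / (2 * r) := fun i j => by push_cast; field_simp
    have c1 : ∀ v : ℤ, 0 ≤ (v : ℝ) / r ↔ 0 ≤ v := fun v => by
      rw [le_div_iff₀ hr0, zero_mul]; norm_cast
    have c2 : ∀ v : ℤ, (v : ℝ) / r ≤ k ↔ v ≤ k * r := fun v => by
      rw [div_le_iff₀ hr0]; norm_cast
    have c2' : ∀ v : ℤ, (v : ℝ) / r ≤ 1 ↔ v ≤ r := fun v => by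
      rw [div_le_iff₀ hr0, one_mul]; norm_cast
    have c3 : ∀ v : ℤ, (k : ℝ) - 1 < (v : ℝ) / r ↔ ((k : ℤ) - 1) * r < v := fun v => by
      rw [lt_div_iff₀ hr0]; norm_cast
    have c4 : ∀ v : ℤ, 0 ≤ (v : ℝ) / (2 * r) ↔ 0 ≤ v := fun v => by
      rw [le_div_iff₀ (by positivity), zero_mul]; norm_cast
    have c5 : ∀ v : ℤ, (v : ℝ) / (2 * r) ≤ 1 ↔ v ≤ 2 * r := fun v => by
      rw [div_le_iff₀ (by positivity), one_mul]; norm_cast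
    simp only [halfOpenHypersimplex, parallelepiped, Set.mem_ofPred_eq, Pi.smul_apply, smul_eq_mul,
      e1, e2, c1, c2, c2', c3, c4, c5, hypersimplexPoints, InSlab]
    constructor
    · rintro ⟨⟨h1, h2⟩, h3⟩
      refine ⟨fun a b hab => ?_, ?_⟩
      · rcases Letter.covBy_cases hab with ⟨i, hi, rfl, rfl⟩ | ⟨i, j, hij, rfl, rfl⟩ |
          ⟨i, j, hij, rfl, rfl⟩
        · have := h1 i hi
          rw [oddExt_neg, oddExt_pos]
          omega
        · have := h2 i j hij
          rw [oddExt_pos, oddExt_pos]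
          omega
        · have := h2 i j hij
          rw [oddExt_neg, oddExt_neg, oddExt_pos, oddExt_pos]
          omega
      · rw [hpl ⟨n - 1, by omega⟩ (by simp; omega), oddExt_pos]
        exact h3 _ (by simp; omega)
    · rintro ⟨h1, h2⟩
      refine ⟨⟨fun i hi => ?_, fun i j hij => ?_⟩, fun i hi => ?_⟩
      · have := h1 _ _ (Letter.neg_pos_covBy_pos hi)
        rw [oddExt_neg, oddExt_pos] at this
        omega
      · have := h1 _ _ (Letter.pos_covBy_pos hij)
        rwa [oddExt_pos, oddExt_pos] at this
      · rwa [hpl i hi, oddExt_pos] at h2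
  ext x
  constructor
  · rintro ⟨h1, h2⟩
    choose y hy using h2
    obtain rfl : x = fun i => (y i : ℝ) / 2 := funext hy
    exact ⟨y, (key y).1 h1, rfl⟩
  · rintro ⟨y, hy, rfl⟩
    exact ⟨(key y).2 hy, fun i => ⟨y i, rfl⟩⟩

end ehrhart

end TypeC

/-! ### The Ehrhart series -/

theorem theoremA (n k : ℕ) (hn : 1 ≤ n) (hk : 1 ≤ k) :
    TypeC.IsHStarPolynomial (TypeC.halfLattice n) (TypeC.halfOpenHypersimplex n k)
      (∑ w : TypeC.SignedPerm n with TypeC.InX w ∧ TypeC.cdes w⁻¹ = k,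
        (Polynomial.X : Polynomial ℤ) ^ TypeC.basc w) := by
  have heval : ∀ r : ℕ, (∑ w : TypeC.SignedPerm n with TypeC.InX w ∧ TypeC.cdes w⁻¹ = k,
      Polynomial.preHilbertPoly ℚ n (TypeC.basc w)).eval (r : ℚ) =
      ∑ w : TypeC.SignedPerm n with TypeC.InX w ∧ TypeC.cdes w⁻¹ = k,
        (((r + n - TypeC.basc w).choose n : ℕ) : ℚ) := fun r => by
    rw [Polynomial.eval_finsetSum]
    exact Finset.sum_congr rfl fun w _ => TypeC.eval_preHilbertPoly (TypeC.basc_le hn w) r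
  refine ⟨∑ w : TypeC.SignedPerm n with TypeC.InX w ∧ TypeC.cdes w⁻¹ = k,
    Polynomial.preHilbertPoly ℚ n (TypeC.basc w), fun r hr => ?_, ?_⟩
  · obtain ⟨hfin, hcard⟩ := TypeC.card_hypersimplexPoints hn hk hr
    have hinj : Function.Injective fun (y : Fin n → ℤ) (i : Fin n) => (y i : ℝ) / 2 := by
      intro y z h
      funext i
      have := congrFun h i
      simpa using this
    rw [TypeC.smul_inter_halfLattice hn k hr, Set.ncard_image_of_injective _ hinj, hcard, heval]
    exact ⟨hfin.image _, by push_cast; rfl⟩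
  · simp only [heval]
    by_cases hk' : k < 2 * n
    · rw [TypeC.dim_halfOpenHypersimplex hn hk hk']
      have hsum : PowerSeries.mk (fun r : ℕ =>
          ∑ w : TypeC.SignedPerm n with TypeC.InX w ∧ TypeC.cdes w⁻¹ = k,
            (((r + n - TypeC.basc w).choose n : ℕ) : ℚ)) =
          ∑ w : TypeC.SignedPerm n with TypeC.InX w ∧ TypeC.cdes w⁻¹ = k,
            PowerSeries.mk fun r : ℕ => (((r + n - TypeC.basc w).choose n : ℕ) : ℚ) := by
        ext r
        simp only [map_sum, PowerSeries.coeff_mk]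
      rw [hsum, Finset.sum_mul, Polynomial.map_sum, ← Polynomial.coeToPowerSeries.ringHom_apply,
        map_sum]
      refine Finset.sum_congr rfl fun w _ => ?_
      rw [TypeC.mk_choose_mul_one_sub_pow (TypeC.basc_le hn w)]
      simp
    -- For `k ≥ 2n` the index set is empty, so both sides vanish whatever the dimension is.
    · have hempty : (Finset.univ.filter fun w : TypeC.SignedPerm n =>
          TypeC.InX w ∧ TypeC.cdes w⁻¹ = k) = ∅ := by
        refine Finset.filter_eq_empty_iff.2 fun w _ hw => hk' ?_
        rw [← hw.2]
        exact TypeC.cdes_lt hn hw.1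
      rw [hempty]
      simp only [Finset.sum_empty, Polynomial.map_zero, Polynomial.coe_zero]
      have : PowerSeries.mk (fun _ : ℕ => (0 : ℚ)) = 0 := by ext; simp
      rw [this, zero_mul]
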